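/- Let $m\in\mathbb N$, $\gamma_0,\dots,\gamma_m\in(0,1]$, $\alpha_k=\sum_{j=0}^k\gamma_j-1$, $\alpha=\alpha_m>0$, $s\ge 0$, $\lambda\in\mathbb C$ and $A_0,\dots,A_{m-1}\in\mathbb C$. For real $\gamma$ let $D_{0y}^{\gamma}$ be the Riemann–Liouville operator with origin $0$: $D_{0y}^{\gamma}g(y)=\frac1{\Gamma(-\gamma)}\int_0^y\frac{g(t)\,dt}{|y-t|^{1+\gamma}}$ for $\gamma<0$, $D_{0y}^{0}g=g$, and $D_{0y}^{\gamma}g=\left(\frac{d}{dy}\right)^pD_{0y}^{\gamma-p}g$ for $p-1<\gamma\le p$, $p\in\mathbb N$. Put $$D_{0y}^{\{\gamma_0,\dots,\gamma_m\}}=D_{0y}^{\gamma_m-1}D_{0y}^{\gamma_{m-1}}\cdots D_{0y}^{\gamma_0},\qquad D_{0y}^{\alpha_0}=D_{0y}^{\gamma_0-1},\quad D_{0y}^{\alpha_k}=D_{0y}^{\gamma_k-1}\frac{d}{dy}D_{0y}^{\alpha_{k-1}}\ (k\ge1).$$ Let $$E_{\alpha,\mu,l}(z)=\sum_{i=0}^\infty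 c_iz^i,\qquad c_i=\prod_{j=0}^{i-1}\frac{\Gamma(\alpha(j\mu+l)+1)}{\Gamma(\alpha(j\mu+l+1)+1)},\quad c_0=1,$$ be the Kilbas–Saigo function. Consider the Cauchy problem $$D_{0y}^{\{\gamma_0,\dots,\gamma_m\}}u(y)=\lambda y^su(y)\quad(y>0),\qquad \lim_{y\to0+}D_{0y}^{\alpha_k}u(y)=A_k\quad(k=0,\dots,m-1),\tag{P}$$ where a solution is a function $u:(0,\infty)\to\mathbb C$ for which all the (Lebesgue) integrals and derivatives in $D_{0y}^{\{\gamma_0,\dots,\gamma_m\}}u(y)$ exist at every $y>0$ and for which (P) holds. Let $$U(y)=\sum_{k=0}^{m-1}\frac{A_ky^{\alpha_k}}{\Gamma(\alpha_k+1)}\,E_{\alpha,\frac{\alpha+s}{\alpha},\frac{\alpha_k+s}{\alpha}}\!\left(\lambda y^{\alpha+s}\right),\qquad y>0.$$ Then the series of the Kilbas–Saigo functions $E_{\alpha,\frac{\alpha+s}{\alpha},\frac{\alpha_k+s}{\alpha}}(z)$, $0\le k<m$, converge absolutely for all $z\in\mathbb C$, $U$ is continuous on $(0,\infty)$, and: 1.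 If $\lambda=0$, or if $\alpha+s+\alpha_k>\alpha_{m-1}$ for every $k\in\{0,\dots,m-1\}$ with $A_k\ne0$ (in particular, whenever $s+\gamma_0+\gamma_m>1$), then $U$ is a solution of (P). 2. Every solution $u$ of (P) satisfies $u(y)=U(y)$ for almost every $y>0$, and for every $y>0$ if $u$ is continuous on $(0,\infty)$. -/

import Mathlib

open Set Filter Topology MeasureTheory

noncomputable section

/-- The kernel integrand `g(t) / |y - t|^(1+γ)` of the Riemann-Liouville integral of order
`γ < 0` with origin `0`. -/
def rlIntegrand (γ : ℝ) (g : ℝ → ℂ) (y t : ℝ) : ℂ :=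
  g t / ((|y - t| ^ (1 + γ) : ℝ) : ℂ)

/-- The Riemann-Liouville operator `D_{0y}^γ` of order `γ ≤ 0`. -/
def rlNonpos (γ : ℝ) (g : ℝ → ℂ) (y : ℝ) : ℂ :=
  if γ = 0 then g y
  else (1 / (Real.Gamma (-γ) : ℂ)) * ∫ t in (0 : ℝ)..y, rlIntegrand γ g y t

/-- The Riemann-Liouville integro-differentiation operator `D_{0y}^γ` of real order `γ`:
the fractional integral for `γ < 0`, the identity for `γ = 0`, and
`(d/dy)^p D_{0y}^{γ-p}` for `p - 1 < γ ≤ p`, `p = 1, 2, …`. -/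
def rlD (γ : ℝ) (g : ℝ → ℂ) : ℝ → ℂ :=
  if γ ≤ 0 then rlNonpos γ g
  else iteratedDeriv ⌈γ⌉₊ (rlNonpos (γ - (⌈γ⌉₊ : ℝ)) g)

/-- `α_k = γ_0 + … + γ_k - 1`. -/
def dnAlpha (γ : ℕ → ℝ) (k : ℕ) : ℝ := (∑ j ∈ Finset.range (k + 1), γ j) - 1

/-- `D_{0y}^{γ_{k-1}} ⋯ D_{0y}^{γ_1} D_{0y}^{γ_0}` (the identity for `k = 0`). -/
def rlComp (γ : ℕ → ℝ) : ℕ → (ℝ → ℂ) → ℝ → ℂ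
  | 0, u => u
  | k + 1, u => rlD (γ k) (rlComp γ k u)

/-- The Dzhrbashyan-Nersesyan operator
`D_{0y}^{γ_0, …, γ_m} = D_{0y}^{γ_m - 1} D_{0y}^{γ_{m-1}} ⋯ D_{0y}^{γ_0}`.
Only the values `γ 0, …, γ m` matter. -/
def dnOp (γ : ℕ → ℝ) (m : ℕ) (u : ℝ → ℂ) : ℝ → ℂ :=
  rlD (γ m - 1) (rlComp γ m u)

/-- The operators `D_{0y}^{α_k}` of the initial conditions:
`D^{α_0} = D^{γ_0 - 1}`, `D^{α_k} = D^{γ_k - 1} (d/dy) D^{α_{k-1}}`. -/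
def dnAlphaOp (γ : ℕ → ℝ) : ℕ → (ℝ → ℂ) → ℝ → ℂ
  | 0, u => rlD (γ 0 - 1) u
  | k + 1, u => rlD (γ (k + 1) - 1) (deriv (dnAlphaOp γ k u))

theorem rlD_eq_deriv {γ : ℝ} (h0 : 0 < γ) (h1 : γ ≤ 1) (g : ℝ → ℂ) :
    rlD γ g = deriv (rlD (γ - 1) g) := by
  have hc : ⌈γ⌉₊ = 1 := by
    rw [Nat.ceil_eq_iff one_ne_zero]
    simpa using ⟨h0, h1⟩
  have h2 : ¬ γ ≤ 0 := not_le.mpr h0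
  have h3 : γ - 1 ≤ 0 := by linarith
  simp [rlD, hc, h2, h3, iteratedDeriv_one]

/-- The two families of operators agree: `D^{γ_0, …, γ_k} = D^{α_k}`. -/
theorem dnOp_eq_dnAlphaOp {γ : ℕ → ℝ} {m : ℕ} (hγ : ∀ k ≤ m, 0 < γ k ∧ γ k ≤ 1) (u : ℝ → ℂ) :
    ∀ k ≤ m, dnOp γ k u = dnAlphaOp γ k u := by
  intro k
  induction k with
  | zero => intro _; rfl
  | succ k ih =>
    intro hk
    have h := hγ k (by omega)
    have e := ih (by omega)
    simp only [dnOp, dnAlphaOp, rlComp] at e ⊢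
    rw [rlD_eq_deriv h.1 h.2, e]

/-- The integral defining `D_{0y}^γ g(y)` for `γ < 0` exists (as a Lebesgue integral) for
every `y > 0`; nothing is required for `γ = 0`. -/
def RLDefined (γ : ℝ) (g : ℝ → ℂ) : Prop :=
  γ < 0 → ∀ y : ℝ, 0 < y → IntervalIntegrable (rlIntegrand γ g y) volume 0 y

/-- Every integral and every derivative that occurs in `D_{0y}^{γ_0, …, γ_m} u(y)` exists
at every point `y > 0`. -/
structure DNDefined (γ : ℕ → ℝ) (m : ℕ) (u : ℝ → ℂ) : Prop where
  int_zero : RLDefined (γ 0 - 1) u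
  diff : ∀ k < m, ∀ y : ℝ, 0 < y → DifferentiableAt ℝ (dnAlphaOp γ k u) y
  int_succ : ∀ k < m, RLDefined (γ (k + 1) - 1) (deriv (dnAlphaOp γ k u))

/-- `u` solves the Cauchy problem
`D_{0y}^{γ_0, …, γ_m} u(y) = lam y^s u(y)` for `y > 0`, and
`lim_{y → 0+} D_{0y}^{α_k} u(y) = A_k` for `k = 0, …, m - 1`.
Only the values of `u` on `y > 0` matter. -/
structure IsCauchySolution (γ : ℕ → ℝ) (m : ℕ) (s : ℝ) (lam : ℂ) (A : ℕ → ℂ)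
    (u : ℝ → ℂ) : Prop where
  defined : DNDefined γ m u
  equation : ∀ y : ℝ, 0 < y → dnOp γ m u y = lam * ((y ^ s : ℝ) : ℂ) * u y
  initial : ∀ k < m, Tendsto (dnAlphaOp γ k u) (𝓝[>] 0) (𝓝 (A k))

/-- The coefficients of the Kilbas-Saigo function. -/
def kilbasSaigoCoeff (α μ l : ℝ) (i : ℕ) : ℝ :=
  ∏ j ∈ Finset.range i,
    Real.Gamma (α * ((j : ℝ) * μ + l) + 1) / Real.Gamma (α * ((j : ℝ) * μ + l + 1) + 1)

/-- The Kilbas-Saigo function `E_{α, μ, l}(z)`. -/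
def kilbasSaigo (α μ l : ℝ) (z : ℂ) : ℂ :=
  ∑' i : ℕ, (kilbasSaigoCoeff α μ l i : ℂ) * z ^ i

/-- `∑_{k<m} A_k y^{α_k} / Γ(α_k + 1) · E_{α, (α+s)/α, (α_k+s)/α}(lam y^{α+s})`, `α = α_m`. -/
def cauchyFormula (γ : ℕ → ℝ) (m : ℕ) (s : ℝ) (lam : ℂ) (A : ℕ → ℂ) (y : ℝ) : ℂ :=
  ∑ k ∈ Finset.range m,
    A k * ((y ^ dnAlpha γ k : ℝ) : ℂ) / (Real.Gamma (dnAlpha γ k + 1) : ℂ) *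
      kilbasSaigo (dnAlpha γ m) ((dnAlpha γ m + s) / dnAlpha γ m)
        ((dnAlpha γ k + s) / dnAlpha γ m) (lam * ((y ^ (dnAlpha γ m + s) : ℝ) : ℂ))

end

/-!
Every solution of the Cauchy problem satisfies, almost everywhere, the Volterra equation
`u = ∑ A_k y^(α_k) / Γ(α_k + 1) + I^α (lam y^s u)`, where `I^a` (`fracInt`) is the fractional
integral of order `a`, the convolution with the kernel `K_a(x) = x₊^(a-1) / Γ(a)` (`rlKernel`).
Euler's beta integral gives `K_a * K_b = K_(a+b)`, hence the semigroup property `fracInt_fracInt`.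

*Uniqueness.* For a solution `u`, each `D^{α_k} u` with `k < m` is differentiable with limit `A_k`
at the origin and has a locally integrable derivative, so that the definition of `D^{α_(k+1)}`
inverts to `D^{α_k} u = A_k + I^{γ_(k+1)} D^{α_(k+1)} u`
(`IsCauchySolution.dnAlphaOp_eq`). Substituting these identities into each other under `I^{γ_0}`
gives the Volterra equation integrated once (`IsCauchySolution.fracInt_one_eq`). Every function in
this computation is either bounded near the origin or integrated to an order of at least one, so
the semigroup property holds at every point. The formula satisfies the same integrated equation,
so that the difference `v` of the two solves `v = I^α (lam y^s v)` almost everywhere; as `I^α` has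
norm at most `κ^(-α)` on `L¹` with the weight `exp (-κ y)`, the difference vanishes
(`ae_eq_zero_of_eq_fracInt`).

*Existence.* The formula is a series `∑ b_p K_(q_p)(y)` over the pairs `p = (k, i)`, with
`q_p = α_k + 1 + i (α + s)`. Such series (`kernelSeries`) may be integrated to fractional order and
differentiated termwise, because their absolute convergence persists under shifts of the exponents
(`KernelSummable`). Hence `D^{α_j}` lowers all exponents by `α_j`, and removes the leading powers
`y^(α_k)` with `k < j`, since each of them becomes a constant that the next derivative annihilates.
The compatibility condition says that the remaining powers stay integrable after every derivative
and vanish at the origin where they must. The recursion of the Kilbas-Saigo coefficients identifies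
what `D^{α_m}` leaves with `lam y^s` times the formula (`mul_cauchyFormula_eq_kernelSeries`).
-/

/-! ### Kernels and fractional integrals -/

/-- The Riemann-Liouville kernel `x₊^(a-1) / Γ(a)`, extended by zero to `x ≤ 0`. -/
noncomputable def rlKernel (a x : ℝ) : ℝ :=
  if 0 < x then x ^ (a - 1) / Real.Gamma a else 0

/-- The fractional integral of order `a > 0` with origin `0`, as a convolution with the kernel
`rlKernel a`, which vanishes beyond the point `y`. -/
noncomputable def fracInt (a : ℝ) (f : ℝ → ℂ) (y : ℝ) : ℂ :=
  ∫ t in Ioi (0 : ℝ), (rlKernel a (y - t) : ℂ) * f t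

/-- The integral defining `fracInt a f y` converges absolutely. -/
def FracIntegrable (a : ℝ) (f : ℝ → ℂ) (y : ℝ) : Prop :=
  IntegrableOn (fun t => (rlKernel a (y - t) : ℂ) * f t) (Ioi 0)

theorem rlKernel_of_pos {a x : ℝ} (hx : 0 < x) :
    rlKernel a x = x ^ (a - 1) / Real.Gamma a := if_pos hx

theorem rlKernel_of_nonpos {a x : ℝ} (hx : x ≤ 0) : rlKernel a x = 0 := if_neg hx.not_gt

theorem rlKernel_nonneg {a : ℝ} (ha : 0 < a) (x : ℝ) : 0 ≤ rlKernel a x := by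
  unfold rlKernel
  split_ifs with h
  · have := Real.Gamma_pos_of_pos ha
    positivity
  · exact le_rfl

theorem measurable_rlKernel (a : ℝ) : Measurable (rlKernel a) :=
  Measurable.ite measurableSet_Ioi (by fun_prop) measurable_const

theorem rlKernel_one_of_pos {x : ℝ} (hx : 0 < x) : rlKernel 1 x = 1 := by
  simp [rlKernel_of_pos hx]

/-! ### The convolution semigroup of kernels -/

/-- Euler's beta integral on the interval `[0, x]`. -/
theorem integral_rpow_mul_sub_rpow {a b x : ℝ} (ha : 0 < a) (hb : 0 < b) (hx : 0 < x) :
    ∫ t in (0 : ℝ)..x, t ^ (b - 1) * (x - t) ^ (a - 1) =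
      x ^ (a + b - 1) * (Real.Gamma a * Real.Gamma b / Real.Gamma (a + b)) := by
  have h := Complex.betaIntegral_scaled (b : ℂ) (a : ℂ) hx
  rw [Complex.betaIntegral_eq_Gamma_mul_div _ _ (by simpa) (by simpa)] at h
  apply Complex.ofReal_injective
  rw [← intervalIntegral.integral_ofReal]
  have e : x ^ (a + b - 1) * (Real.Gamma a * Real.Gamma b / Real.Gamma (a + b))
      = x ^ (b + a - 1) * (Real.Gamma b * Real.Gamma a / Real.Gamma (b + a)) := by
    rw [add_comm a b, mul_comm (Real.Gamma a)]
  rw [e]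
  push_cast
  rw [Complex.ofReal_cpow hx.le, ← Complex.Gamma_ofReal, ← Complex.Gamma_ofReal,
    ← Complex.Gamma_ofReal]
  push_cast
  rw [← h]
  refine intervalIntegral.integral_congr fun t ht => ?_
  rw [uIcc_of_le hx.le] at ht
  rw [Complex.ofReal_cpow ht.1, Complex.ofReal_cpow (sub_nonneg.2 ht.2)]
  push_cast
  rfl

theorem rlKernel_mul_rlKernel_eq_indicator (a b x t : ℝ) :
    rlKernel a (x - t) * rlKernel b t = (Ioo 0 x).indicator (fun t =>
      (t ^ (b - 1) * (x - t) ^ (a - 1)) * (Real.Gamma a * Real.Gamma b)⁻¹) t := by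
  by_cases h : t ∈ Ioo 0 x
  · rw [indicator_of_mem h, rlKernel_of_pos (sub_pos.2 h.2), rlKernel_of_pos h.1,
      div_mul_div_comm, div_eq_mul_inv, mul_comm (t ^ (b - 1))]
  · rw [indicator_of_notMem h]
    by_cases h0 : 0 < t
    · rw [rlKernel_of_nonpos (a := a), zero_mul]
      exact sub_nonpos.2 (not_lt.1 fun h1 => h ⟨h0, h1⟩)
    · rw [rlKernel_of_nonpos (a := b) (not_lt.1 h0), mul_zero]

theorem integrable_rlKernel_conv_zero {a b : ℝ} (ha : 0 < a) (hb : 0 < b) (x : ℝ) :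
    Integrable fun t => rlKernel a (x - t) * rlKernel b t := by
  simp_rw [rlKernel_mul_rlKernel_eq_indicator]
  rw [integrable_indicator_iff measurableSet_Ioo]
  rcases le_or_gt x 0 with hx | hx
  · simp [Ioo_eq_empty_of_le hx]
  refine Integrable.mul_const ?_ _
  -- an interval integral with a nonzero value is that of an integrable function
  have := intervalIntegral.intervalIntegrable_of_integral_ne_zero
    (μ := volume) (a := 0) (b := x) (f := fun t : ℝ => t ^ (b - 1) * (x - t) ^ (a - 1)) (by
      rw [integral_rpow_mul_sub_rpow ha hb hx]
      have := Real.Gamma_pos_of_pos ha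
      have := Real.Gamma_pos_of_pos hb
      have := Real.Gamma_pos_of_pos (add_pos ha hb)
      positivity)
  exact ((intervalIntegrable_iff_integrableOn_Ioo_of_le hx.le).1 this)

theorem integral_rlKernel_conv_zero {a b : ℝ} (ha : 0 < a) (hb : 0 < b) (x : ℝ) :
    ∫ t, rlKernel a (x - t) * rlKernel b t = rlKernel (a + b) x := by
  simp_rw [rlKernel_mul_rlKernel_eq_indicator]
  rw [integral_indicator measurableSet_Ioo]
  rcases le_or_gt x 0 with hx | hx
  · simp [Ioo_eq_empty_of_le hx, rlKernel_of_nonpos hx]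
  rw [integral_mul_const, ← integral_Ioc_eq_integral_Ioo, ← intervalIntegral.integral_of_le hx.le,
    integral_rpow_mul_sub_rpow ha hb hx, rlKernel_of_pos hx]
  have := Real.Gamma_pos_of_pos ha
  have := Real.Gamma_pos_of_pos hb
  field_simp

theorem integrable_rlKernel_conv {a b : ℝ} (ha : 0 < a) (hb : 0 < b) (y s : ℝ) :
    Integrable fun t => rlKernel a (y - t) * rlKernel b (t - s) := by
  have := (integrable_rlKernel_conv_zero ha hb (y - s)).comp_sub_right s
  simpa using this

/-- The kernels form a convolution semigroup. -/
theorem integral_rlKernel_conv {a b : ℝ} (ha : 0 < a) (hb : 0 < b) (y s : ℝ) :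
    ∫ t, rlKernel a (y - t) * rlKernel b (t - s) = rlKernel (a + b) (y - s) := by
  rw [← integral_rlKernel_conv_zero ha hb (y - s),
    ← integral_sub_right_eq_self (fun t => rlKernel a (y - s - t) * rlKernel b t) s]
  simp

theorem setIntegral_rlKernel_mul_rlKernel {a q : ℝ} (ha : 0 < a) (hq : 0 < q) (y : ℝ) :
    ∫ t in Ioi (0 : ℝ), rlKernel a (y - t) * rlKernel q t = rlKernel (a + q) y := by
  rw [← integral_rlKernel_conv_zero ha hq y, setIntegral_eq_integral_of_forall_compl_eq_zero]
  intro t ht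
  rw [rlKernel_of_nonpos (a := q) (not_lt.1 ht), mul_zero]

theorem setIntegral_rlKernel_conv {a b : ℝ} (ha : 0 < a) (hb : 0 < b) (y : ℝ) {s : ℝ}
    (hs : 0 < s) :
    ∫ t in Ioi (0 : ℝ), rlKernel a (y - t) * rlKernel b (t - s) = rlKernel (a + b) (y - s) := by
  rw [← integral_rlKernel_conv ha hb y, setIntegral_eq_integral_of_forall_compl_eq_zero]
  intro t ht
  rw [rlKernel_of_nonpos (a := b), mul_zero]
  have : t ≤ 0 := not_lt.1 ht
  linarith

/-! ### The semigroup of fractional integrals -/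

/-- The double integral behind the semigroup property converges absolutely as soon as the single
integral of order `a + b` does. -/
theorem integrable_prod_rlKernel {a b y : ℝ} {f : ℝ → ℂ} (ha : 0 < a) (hb : 0 < b)
    (hm : AEStronglyMeasurable f (volume.restrict (Ioi 0))) (hf : FracIntegrable (a + b) f y) :
    Integrable (fun p : ℝ × ℝ =>
      ((rlKernel a (y - p.1) * rlKernel b (p.1 - p.2) : ℝ) : ℂ) * f p.2)
      ((volume.restrict (Ioi 0)).prod (volume.restrict (Ioi 0))) := by
  have hmeas : AEStronglyMeasurable (fun p : ℝ × ℝ =>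
      ((rlKernel a (y - p.1) * rlKernel b (p.1 - p.2) : ℝ) : ℂ) * f p.2)
      ((volume.restrict (Ioi 0)).prod (volume.restrict (Ioi 0))) := by
    refine AEStronglyMeasurable.mul ?_ hm.comp_snd
    have h1 := measurable_rlKernel a
    have h2 := measurable_rlKernel b
    have : Measurable fun p : ℝ × ℝ =>
        ((rlKernel a (y - p.1) * rlKernel b (p.1 - p.2) : ℝ) : ℂ) := by fun_prop
    exact this.aestronglyMeasurable
  rw [integrable_prod_iff' hmeas]
  refine ⟨.of_forall fun s => ?_, ?_⟩
  · exact ((integrable_rlKernel_conv ha hb y s).integrableOn (s := Ioi 0)).ofReal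
      (𝕜 := ℂ) |>.mul_const (f s)
  · refine (integrable_congr ?_).1 hf.norm
    filter_upwards [ae_restrict_mem measurableSet_Ioi] with s hs
    have h0 : ∀ t, ‖((rlKernel a (y - t) * rlKernel b (t - s) : ℝ) : ℂ) * f s‖ =
        (rlKernel a (y - t) * rlKernel b (t - s)) * ‖f s‖ := fun t => by
      rw [norm_mul, Complex.norm_real, Real.norm_of_nonneg
        (mul_nonneg (rlKernel_nonneg ha _) (rlKernel_nonneg hb _))]
    simp only [h0]
    rw [integral_mul_const, setIntegral_rlKernel_conv ha hb y hs, norm_mul, Complex.norm_real,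
      Real.norm_of_nonneg (rlKernel_nonneg (add_pos ha hb) _)]

theorem fracIntegrable_fracInt {a b y : ℝ} {f : ℝ → ℂ} (ha : 0 < a) (hb : 0 < b)
    (hm : AEStronglyMeasurable f (volume.restrict (Ioi 0))) (hf : FracIntegrable (a + b) f y) :
    FracIntegrable a (fracInt b f) y := by
  refine (integrable_congr (.of_forall fun t => ?_)).1
    (integrable_prod_rlKernel ha hb hm hf).integral_prod_left
  simp only [fracInt]
  rw [← integral_const_mul]
  refine integral_congr_ae (.of_forall fun s => ?_)
  simp only
  push_cast
  ring

/-- The semigroup property of fractional integration. -/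
theorem fracInt_fracInt {a b y : ℝ} {f : ℝ → ℂ} (ha : 0 < a) (hb : 0 < b)
    (hm : AEStronglyMeasurable f (volume.restrict (Ioi 0))) (hf : FracIntegrable (a + b) f y) :
    fracInt a (fracInt b f) y = fracInt (a + b) f y := by
  have h := integral_integral_swap
    (f := fun t s => ((rlKernel a (y - t) * rlKernel b (t - s) : ℝ) : ℂ) * f s)
    (integrable_prod_rlKernel ha hb hm hf)
  have h1 : fracInt a (fracInt b f) y = ∫ t in Ioi (0 : ℝ), ∫ s in Ioi (0 : ℝ),
      ((rlKernel a (y - t) * rlKernel b (t - s) : ℝ) : ℂ) * f s := by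
    simp only [fracInt]
    refine integral_congr_ae (.of_forall fun t => ?_)
    simp only
    rw [← integral_const_mul]
    refine integral_congr_ae (.of_forall fun s => ?_)
    simp only
    push_cast
    ring
  rw [h1, h, fracInt]
  refine setIntegral_congr_fun measurableSet_Ioi fun s hs => ?_
  rw [integral_mul_const, integral_complex_ofReal, setIntegral_rlKernel_conv ha hb y hs]

/-! ### The operators `rlD` as fractional integrals -/

theorem fracInt_congr {a y : ℝ} {f g : ℝ → ℂ} (h : EqOn f g (Ioi 0)) :
    fracInt a f y = fracInt a g y :=
  setIntegral_congr_fun measurableSet_Ioi fun t ht => by simp only [h ht]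

theorem fracIntegrable_congr {a y : ℝ} {f g : ℝ → ℂ} (h : EqOn f g (Ioi 0)) :
    FracIntegrable a f y ↔ FracIntegrable a g y :=
  integrableOn_congr_fun (fun t ht => by simp only [h ht]) measurableSet_Ioi

theorem rlKernel_mul_eq_indicator (a y : ℝ) (f : ℝ → ℂ) (t : ℝ) :
    (rlKernel a (y - t) : ℂ) * f t = (Iio y).indicator
      (fun t => (((y - t) ^ (a - 1) / Real.Gamma a : ℝ) : ℂ) * f t) t := by
  by_cases h : t < y
  · rw [indicator_of_mem (show t ∈ Iio y from h), rlKernel_of_pos (sub_pos.2 h)]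
  · rw [indicator_of_notMem (show t ∉ Iio y from h),
      rlKernel_of_nonpos (sub_nonpos.2 (not_lt.1 h))]
    simp

theorem fracInt_eq_setIntegral (a y : ℝ) (f : ℝ → ℂ) :
    fracInt a f y =
      ∫ t in Ioo 0 y, (((y - t) ^ (a - 1) / Real.Gamma a : ℝ) : ℂ) * f t := by
  unfold fracInt
  simp_rw [rlKernel_mul_eq_indicator]
  rw [setIntegral_indicator measurableSet_Iio, Ioi_inter_Iio]

theorem fracIntegrable_iff (a y : ℝ) (f : ℝ → ℂ) :
    FracIntegrable a f y ↔
      IntegrableOn (fun t => (((y - t) ^ (a - 1) / Real.Gamma a : ℝ) : ℂ) * f t) (Ioo 0 y) := by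
  unfold FracIntegrable
  simp_rw [rlKernel_mul_eq_indicator]
  rw [IntegrableOn, integrable_indicator_iff measurableSet_Iio, IntegrableOn,
    Measure.restrict_restrict measurableSet_Iio, Iio_inter_Ioi, IntegrableOn]

theorem fracInt_one {y : ℝ} (hy : 0 ≤ y) (f : ℝ → ℂ) :
    fracInt 1 f y = ∫ t in (0 : ℝ)..y, f t := by
  rw [fracInt_eq_setIntegral, intervalIntegral.integral_of_le hy, integral_Ioc_eq_integral_Ioo]
  simp

theorem fracIntegrable_one {y : ℝ} (f : ℝ → ℂ) :
    FracIntegrable 1 f y ↔ IntegrableOn f (Ioo 0 y) := by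
  rw [fracIntegrable_iff]
  simp

theorem rlIntegrand_eq {a y t : ℝ} (g : ℝ → ℂ) (ht : t < y) :
    rlIntegrand (-a) g y t = (((y - t) ^ (a - 1) : ℝ) : ℂ) * g t := by
  have h : 0 < y - t := sub_pos.2 ht
  rw [rlIntegrand, abs_of_pos h, show a - 1 = -(1 + -a) by ring, Real.rpow_neg h.le]
  push_cast
  rw [div_eq_mul_inv, mul_comm]

theorem intervalIntegrable_rlIntegrand {a y : ℝ} (ha : 0 < a) (hy : 0 < y) (g : ℝ → ℂ) :
    IntervalIntegrable (rlIntegrand (-a) g y) volume 0 y ↔ FracIntegrable a g y := by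
  rw [intervalIntegrable_iff_integrableOn_Ioo_of_le hy.le, fracIntegrable_iff,
    integrableOn_congr_fun (fun t ht => rlIntegrand_eq g ht.2) measurableSet_Ioo]
  have hΓ : ((Real.Gamma a)⁻¹ : ℂ) ≠ 0 := by
    have := (Real.Gamma_pos_of_pos ha).ne'
    simpa using this
  rw [IntegrableOn, IntegrableOn, ← integrable_const_mul_iff (IsUnit.mk0 _ hΓ)]
  refine integrable_congr (.of_forall fun t => ?_)
  simp only
  push_cast
  ring

theorem rlNonpos_neg {a y : ℝ} (ha : 0 < a) (hy : 0 < y) (g : ℝ → ℂ) :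
    rlNonpos (-a) g y = fracInt a g y := by
  rw [rlNonpos, if_neg (by linarith), fracInt_eq_setIntegral, neg_neg,
    intervalIntegral.integral_of_le hy.le, integral_Ioc_eq_integral_Ioo, ← integral_const_mul]
  refine setIntegral_congr_fun measurableSet_Ioo fun t ht => ?_
  rw [rlIntegrand_eq g ht.2]
  push_cast
  ring

theorem rlD_sub_one_of_lt {γ y : ℝ} (h1 : γ < 1) (hy : 0 < y) (g : ℝ → ℂ) :
    rlD (γ - 1) g y = fracInt (1 - γ) g y := by
  rw [rlD, if_pos (by linarith), ← rlNonpos_neg (by linarith) hy]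
  ring_nf

theorem rlD_one_sub_one (g : ℝ → ℂ) : rlD (1 - 1) g = g := by
  ext y
  simp [rlD, rlNonpos]

theorem rlDefined_iff {γ : ℝ} (h1 : γ < 1) (g : ℝ → ℂ) :
    RLDefined (γ - 1) g ↔ ∀ y, 0 < y → FracIntegrable (1 - γ) g y := by
  have h : ∀ y, 0 < y → (IntervalIntegrable (rlIntegrand (γ - 1) g y) volume 0 y ↔
      FracIntegrable (1 - γ) g y) := fun y hy => by
    rw [← intervalIntegrable_rlIntegrand (by linarith) hy, neg_sub]
  simp only [RLDefined, sub_neg, h1, true_imp_iff]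
  exact forall₂_congr h

/-! ### Generalized power series -/

/-- The generalized power series `∑ b_i y^(q_i - 1) / Γ(q_i)` on `y > 0`. Since Lean evaluates
`1 / Γ(0)` to `0`, its termwise derivative is the series with exponents `q_i - 1`, without
exception for `q_i = 1`. -/
noncomputable def kernelSeries {ι : Type*} (b : ι → ℂ) (q : ι → ℝ) (y : ℝ) : ℂ :=
  ∑' i, b i * (rlKernel (q i) y : ℂ)

/-- The exponents tend to infinity and the series `kernelSeries b q` converges absolutely at every
`y > 0`. This condition is stable under every shift of the exponents. -/
structure KernelSummable {ι : Type*} (b : ι → ℂ) (q : ι → ℝ) : Prop where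
  tendsto : Tendsto q cofinite atTop
  summable : ∀ y, 0 < y → Summable fun i => ‖b i‖ * |rlKernel (q i) y|

namespace KernelSummable

variable {ι : Type*} {b : ι → ℂ} {q : ι → ℝ}

theorem mono {b' : ι → ℂ} (h : KernelSummable b q) (hb : ∀ i, ‖b' i‖ ≤ ‖b i‖) :
    KernelSummable b' q := by
  refine ⟨h.tendsto, fun y hy => (h.summable y hy).of_nonneg_of_le (fun i => by positivity)
    fun i => ?_⟩
  exact mul_le_mul_of_nonneg_right (hb i) (abs_nonneg _)

theorem summable_norm (h : KernelSummable b q) {y : ℝ} (hy : 0 < y) :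
    Summable fun i => ‖b i * (rlKernel (q i) y : ℂ)‖ := by
  simpa using h.summable y hy

theorem add_const (h : KernelSummable b q) {a : ℝ} (ha : 0 ≤ a) :
    KernelSummable b fun i => q i + a := by
  refine ⟨tendsto_atTop_add_const_right _ _ h.tendsto, fun y hy => ?_⟩
  refine ((h.summable y hy).mul_left (y ^ a)).of_norm_bounded_eventually ?_
  filter_upwards [h.tendsto.eventually_ge_atTop 2] with i hi
  have h1 : 0 < q i := by linarith
  have hΓ : Real.Gamma (q i) ≤ Real.Gamma (q i + a) :=
    Real.Gamma_strictMonoOn_Ici.monotoneOn hi (by simp only [mem_Ici]; linarith) (by linarith)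
  have hΓ0 := Real.Gamma_pos_of_pos h1
  rw [Real.norm_of_nonneg (by positivity), abs_of_nonneg (rlKernel_nonneg (by linarith) _),
    abs_of_nonneg (rlKernel_nonneg h1 _), mul_left_comm]
  refine mul_le_mul_of_nonneg_left ?_ (norm_nonneg _)
  rw [rlKernel_of_pos hy, rlKernel_of_pos hy, show q i + a - 1 = a + (q i - 1) by ring,
    Real.rpow_add hy, mul_div_assoc]
  gcongr

theorem sub_one (h : KernelSummable b q) : KernelSummable b fun i => q i - 1 := by
  refine ⟨tendsto_atTop_add_const_right _ (-1) h.tendsto, fun y hy => ?_⟩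
  refine ((h.summable (Real.exp 1 * y) (by positivity)).mul_left
    y⁻¹).of_norm_bounded_eventually ?_
  filter_upwards [h.tendsto.eventually_ge_atTop 2] with i hi
  have h1 : 0 < q i := by linarith
  have h2 : 0 < q i - 1 := by linarith
  have hΓ0 := Real.Gamma_pos_of_pos h2
  have hΓ : Real.Gamma (q i) = (q i - 1) * Real.Gamma (q i - 1) := by
    rw [← Real.Gamma_add_one h2.ne', sub_add_cancel]
  rw [Real.norm_of_nonneg (by positivity), abs_of_nonneg (rlKernel_nonneg h2 _),
    abs_of_nonneg (rlKernel_nonneg h1 _), mul_left_comm]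
  refine mul_le_mul_of_nonneg_left ?_ (norm_nonneg _)
  rw [rlKernel_of_pos hy, rlKernel_of_pos (by positivity), hΓ, Real.mul_rpow (by positivity) hy.le,
    Real.exp_one_rpow, Real.rpow_sub_one hy.ne', div_le_iff₀ hΓ0]
  have he : q i - 1 ≤ Real.exp (q i - 1) := by linarith [Real.add_one_le_exp (q i - 1)]
  have e : y⁻¹ * (Real.exp (q i - 1) * y ^ (q i - 1) / ((q i - 1) * Real.Gamma (q i - 1))) *
      Real.Gamma (q i - 1) = y ^ (q i - 1) / y * (Real.exp (q i - 1) / (q i - 1)) := by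
    field_simp
  rw [e]
  exact le_mul_of_one_le_right (by positivity) ((one_le_div h2).2 he)

end KernelSummable

theorem hasDerivAt_rlKernel (q : ℝ) {x : ℝ} (hx : 0 < x) :
    HasDerivAt (rlKernel q) (rlKernel (q - 1) x) x := by
  have h : HasDerivAt (fun x : ℝ => x ^ (q - 1) / Real.Gamma q)
      ((q - 1) * x ^ (q - 1 - 1) / Real.Gamma q) x :=
    (Real.hasDerivAt_rpow_const (Or.inl hx.ne')).div_const _
  have e : (q - 1) * x ^ (q - 1 - 1) / Real.Gamma q = rlKernel (q - 1) x := by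
    rw [rlKernel_of_pos hx]
    rcases eq_or_ne (q - 1) 0 with h0 | h0
    · simp [h0]
    · have hΓ : Real.Gamma q = (q - 1) * Real.Gamma (q - 1) := by
        rw [← Real.Gamma_add_one h0, sub_add_cancel]
      rw [hΓ, mul_div_mul_left _ _ h0]
  rw [← e]
  refine h.congr_of_eventuallyEq ?_
  filter_upwards [lt_mem_nhds hx] with z hz using rlKernel_of_pos hz

theorem abs_rlKernel_le {q x l r : ℝ} (hl : 0 < l) (h1 : l ≤ x) (h2 : x ≤ r) :
    |rlKernel q x| ≤ |rlKernel q l| + |rlKernel q r| := by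
  have hx := hl.trans_le h1
  have hr := hx.trans_le h2
  rw [rlKernel_of_pos hl, rlKernel_of_pos hx, rlKernel_of_pos hr, abs_div, abs_div, abs_div,
    ← add_div, abs_of_pos (Real.rpow_pos_of_pos hl _), abs_of_pos (Real.rpow_pos_of_pos hx _),
    abs_of_pos (Real.rpow_pos_of_pos hr _)]
  gcongr
  have := Real.rpow_pos_of_pos hl (q - 1)
  have := Real.rpow_pos_of_pos hr (q - 1)
  rcases le_total 0 (q - 1) with h | h
  · linarith [Real.rpow_le_rpow hx.le h2 h]
  · linarith [Real.rpow_le_rpow_of_nonpos hl h1 h]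

section

variable {ι : Type*} {b : ι → ℂ} {q : ι → ℝ}

theorem hasDerivAt_kernelSeries (h : KernelSummable b q) {y : ℝ} (hy : 0 < y) :
    HasDerivAt (kernelSeries b q) (kernelSeries b (fun i => q i - 1) y) y := by
  have hs := h.sub_one
  have hmem : y ∈ Ioo (y / 2) (2 * y) := ⟨by linarith, by linarith⟩
  have hg : ∀ i, ∀ x ∈ Ioo (y / 2) (2 * y), HasDerivAt (fun x => b i * (rlKernel (q i) x : ℂ))
      (b i * (rlKernel (q i - 1) x : ℂ)) x := fun i x hx =>
    ((hasDerivAt_rlKernel (q i) (by linarith [hx.1])).ofReal_comp).const_mul _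
  have hg' : ∀ i, ∀ x ∈ Ioo (y / 2) (2 * y), ‖b i * (rlKernel (q i - 1) x : ℂ)‖ ≤
      ‖b i‖ * |rlKernel (q i - 1) (y / 2)| + ‖b i‖ * |rlKernel (q i - 1) (2 * y)| :=
    fun i x hx => by
      rw [norm_mul, Complex.norm_real, Real.norm_eq_abs, ← mul_add]
      exact mul_le_mul_of_nonneg_left (abs_rlKernel_le (by positivity) hx.1.le hx.2.le)
        (norm_nonneg _)
  have hu := (hs.summable (y / 2) (by positivity)).add (hs.summable (2 * y) (by positivity))
  have h0 := (h.summable_norm hy).of_norm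
  exact hasDerivAt_tsum_of_isPreconnected hu isOpen_Ioo isPreconnected_Ioo hg hg' hmem h0 hmem

theorem continuousOn_kernelSeries (h : KernelSummable b q) :
    ContinuousOn (kernelSeries b q) (Ioi 0) := fun _ hy =>
  (hasDerivAt_kernelSeries h hy).continuousAt.continuousWithinAt

theorem tendsto_kernelSeries_zero (h : KernelSummable b q) (hq : ∀ i, b i ≠ 0 → 1 ≤ q i) :
    Tendsto (kernelSeries b q) (𝓝[>] 0) (𝓝 (∑' i, if q i = 1 then b i else 0)) := by
  refine tendsto_tsum_of_dominated_convergence (h.summable 1 one_pos) (fun i => ?_) ?_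
  · rcases eq_or_ne (b i) 0 with h0 | h0
    · simp [h0]
    split_ifs with h1
    · refine tendsto_const_nhds.congr' ?_
      filter_upwards [self_mem_nhdsWithin] with y hy
      rw [h1, rlKernel_one_of_pos hy]
      simp
    · have hlt : 0 < q i - 1 := sub_pos.2 (lt_of_le_of_ne (hq i h0) (Ne.symm h1))
      have ht : Tendsto (fun y : ℝ => y ^ (q i - 1) / Real.Gamma (q i)) (𝓝[>] 0) (𝓝 0) := by
        have := (Real.continuousAt_rpow_const 0 (q i - 1) (Or.inr hlt.le)).tendsto
        rw [Real.zero_rpow hlt.ne'] at this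
        simpa using (this.mono_left nhdsWithin_le_nhds).div_const (Real.Gamma (q i))
      have h2 : Tendsto (rlKernel (q i)) (𝓝[>] 0) (𝓝 0) := by
        refine ht.congr' ?_
        filter_upwards [self_mem_nhdsWithin] with y hy using (rlKernel_of_pos hy).symm
      simpa using ((Complex.continuous_ofReal.tendsto 0).comp h2).const_mul (b i)
  · filter_upwards [Ioo_mem_nhdsGT one_pos] with y hy i
    rw [norm_mul, Complex.norm_real, Real.norm_eq_abs]
    rcases eq_or_ne (b i) 0 with h0 | h0
    · simp [h0]
    have h1 := hq i h0
    have hΓ := Real.Gamma_pos_of_pos (one_pos.trans_le h1)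
    refine mul_le_mul_of_nonneg_left ?_ (norm_nonneg _)
    rw [abs_of_nonneg (rlKernel_nonneg (by linarith) _),
      abs_of_nonneg (rlKernel_nonneg (by linarith) _), rlKernel_of_pos hy.1,
      rlKernel_of_pos one_pos]
    have := Real.rpow_le_rpow hy.1.le hy.2.le (sub_nonneg.2 h1)
    gcongr

/-- The sum of a series of functions converging absolutely in `L¹` is integrable. -/
theorem integrable_tsum_of_summable_integral_norm {α E : Type*} [MeasurableSpace α]
    {μ : Measure α} [NormedAddCommGroup E] [NormedSpace ℝ E] [Countable ι] {F : ι → α → E}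
    (hm : AEStronglyMeasurable (fun x => ∑' i, F i x) μ) (hF : ∀ i, Integrable (F i) μ)
    (hs : Summable fun i => ∫ x, ‖F i x‖ ∂μ) : Integrable (fun x => ∑' i, F i x) μ := by
  refine ⟨hm, ?_⟩
  have h1 : ∫⁻ x, ‖∑' i, F i x‖ₑ ∂μ ≤ ∑' i, ∫⁻ x, ‖F i x‖ₑ ∂μ := by
    rw [← lintegral_tsum fun i => (hF i).1.enorm]
    exact lintegral_mono fun x => enorm_tsum_le_tsum_enorm
  refine h1.trans_lt ?_
  simp_rw [← fun i => ofReal_integral_norm_eq_lintegral_enorm (hF i)]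
  exact hs.tsum_ofReal_lt_top

/-- Fractional integration of order `a` raises all exponents of a kernel series by `a`. -/
theorem fracInt_kernelSeries [Countable ι] (h : KernelSummable b q)
    (hq : ∀ i, b i ≠ 0 → 0 < q i) {a y : ℝ} (ha : 0 < a) (hy : 0 < y) :
    FracIntegrable a (kernelSeries b q) y ∧
      fracInt a (kernelSeries b q) y = kernelSeries b (fun i => q i + a) y := by
  set F : ι → ℝ → ℂ := fun i t =>
    b i * ((rlKernel a (y - t) * rlKernel (q i) t : ℝ) : ℂ) with hFdef
  have hFs : (fun t => (rlKernel a (y - t) : ℂ) * kernelSeries b q t) = fun t => ∑' i, F i t := by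
    ext t
    rw [kernelSeries, ← tsum_mul_left]
    refine tsum_congr fun i => ?_
    simp only [hFdef]
    push_cast
    ring
  have hF : ∀ i, IntegrableOn (F i) (Ioi 0) := fun i => by
    rcases eq_or_ne (b i) 0 with h0 | h0
    · simp [hFdef, h0]
    · exact ((integrable_rlKernel_conv_zero ha (hq i h0) y).integrableOn (s := Ioi 0)).ofReal
        (𝕜 := ℂ) |>.const_mul (b i)
  have hint : ∀ i, ∫ t in Ioi (0 : ℝ), F i t = b i * (rlKernel (q i + a) y : ℂ) := fun i => by
    rcases eq_or_ne (b i) 0 with h0 | h0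
    · simp [hFdef, h0]
    · simp only [hFdef]
      rw [integral_const_mul, integral_complex_ofReal,
        setIntegral_rlKernel_mul_rlKernel ha (hq i h0), add_comm a]
  have hnorm : ∀ i, ∫ t in Ioi (0 : ℝ), ‖F i t‖ = ‖b i‖ * |rlKernel (q i + a) y| := fun i => by
    rcases eq_or_ne (b i) 0 with h0 | h0
    · simp [hFdef, h0]
    · have : ∀ t, ‖F i t‖ = ‖b i‖ * (rlKernel a (y - t) * rlKernel (q i) t) := fun t => by
        rw [hFdef, norm_mul, Complex.norm_real, Real.norm_of_nonneg
          (mul_nonneg (rlKernel_nonneg ha _) (rlKernel_nonneg (hq i h0) _))]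
      simp only [this]
      rw [integral_const_mul, setIntegral_rlKernel_mul_rlKernel ha (hq i h0), add_comm a,
        abs_of_nonneg
        (rlKernel_nonneg (add_pos (hq i h0) ha) _)]
  have hsum : Summable fun i => ∫ t in Ioi (0 : ℝ), ‖F i t‖ := by
    simp only [hnorm]
    exact (h.add_const ha.le).summable y hy
  have hm : AEStronglyMeasurable (fun t => ∑' i, F i t) (volume.restrict (Ioi 0)) := by
    rw [← hFs]
    refine AEStronglyMeasurable.mul ?_
      ((continuousOn_kernelSeries h).aestronglyMeasurable measurableSet_Ioi)
    have h1 := measurable_rlKernel a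
    have : Measurable fun t => (rlKernel a (y - t) : ℂ) := by fun_prop
    exact this.aestronglyMeasurable
  refine ⟨?_, ?_⟩
  · rw [FracIntegrable, hFs]
    exact integrable_tsum_of_summable_integral_norm hm hF hsum
  · rw [fracInt, hFs, ← integral_tsum_of_summable_integral_norm hF hsum, kernelSeries]
    exact tsum_congr hint

end

/-! ### The Kilbas-Saigo function and the formula as a generalized power series -/

theorem KernelSummable.shift {ι : Type*} {b : ι → ℂ} {q : ι → ℝ} (h : KernelSummable b q)
    (r : ℝ) : KernelSummable b fun i => q i + r := by
  have hn : ∀ n : ℕ, KernelSummable b fun i => q i - n := by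
    intro n
    induction n with
    | zero => simpa using h
    | succ n ih =>
      have := ih.sub_one
      simp only [sub_sub] at this
      exact_mod_cast this
  obtain ⟨n, hr⟩ := exists_nat_ge (-r)
  have := (hn n).add_const (a := n + r) (by linarith)
  simpa only [sub_add_add_cancel, sub_add_cancel, ← add_assoc] using this

theorem tendsto_Gamma_div_Gamma_add {a : ℝ} (ha : 0 < a) :
    Tendsto (fun x => Real.Gamma x / Real.Gamma (x + a)) atTop (𝓝 0) := by
  have hlog : Tendsto (fun x : ℝ => Real.exp (-(a * Real.log (x - 1)))) atTop (𝓝 0) := by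
    refine Real.tendsto_exp_neg_atTop_nhds_zero.comp ?_
    exact (Real.tendsto_log_atTop.comp
      (tendsto_atTop_add_const_right _ (-1) tendsto_id)).const_mul_atTop ha
  refine squeeze_zero' ?_ ?_ hlog
  · filter_upwards [eventually_gt_atTop 0] with x hx
    have := Real.Gamma_pos_of_pos hx
    have := Real.Gamma_pos_of_pos (add_pos hx ha)
    positivity
  · filter_upwards [eventually_gt_atTop 1] with x hx
    have h0 : 0 < x - 1 := by linarith
    have hx0 : 0 < x := by linarith
    have hxa : 0 < x + a := by linarith
    -- log-convexity compares the secant slopes over `[x - 1, x]` and `[x, x + a]`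
    have hslope := Real.convexOn_log_Gamma.slope_mono_adjacent (x := x - 1) (y := x) (z := x + a)
      h0 hxa (by linarith) (by linarith)
    have hΓ : Real.Gamma x = (x - 1) * Real.Gamma (x - 1) := by
      rw [← Real.Gamma_add_one h0.ne', sub_add_cancel]
    have hlogΓ : Real.log (Real.Gamma x) = Real.log (x - 1) + Real.log (Real.Gamma (x - 1)) := by
      rw [hΓ, Real.log_mul h0.ne' (Real.Gamma_pos_of_pos h0).ne']
    simp only [Function.comp, sub_sub_cancel, div_one, add_sub_cancel_left] at hslope
    rw [le_div_iff₀ ha, hlogΓ, add_sub_cancel_right, ← hlogΓ] at hslope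
    have hG := Real.Gamma_pos_of_pos hx0
    have hGa := Real.Gamma_pos_of_pos hxa
    rw [← Real.log_le_iff_le_exp (by positivity), Real.log_div hG.ne' hGa.ne']
    linarith

theorem kilbasSaigoCoeff_zero (α μ l : ℝ) : kilbasSaigoCoeff α μ l 0 = 1 := by
  simp [kilbasSaigoCoeff]

theorem kilbasSaigoCoeff_succ (α μ l : ℝ) (i : ℕ) :
    kilbasSaigoCoeff α μ l (i + 1) = kilbasSaigoCoeff α μ l i *
      (Real.Gamma (α * (i * μ + l) + 1) / Real.Gamma (α * (i * μ + l + 1) + 1)) :=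
  Finset.prod_range_succ _ _

theorem summable_kilbasSaigo {α μ : ℝ} (hα : 0 < α) (hμ : 0 < μ) (l : ℝ) (z : ℂ) :
    Summable fun i : ℕ => ‖(kilbasSaigoCoeff α μ l i : ℂ) * z ^ i‖ := by
  have hx : Tendsto (fun i : ℕ => α * (i * μ + l) + 1) atTop atTop :=
    tendsto_atTop_add_const_right _ _ ((tendsto_atTop_add_const_right _ _
      (tendsto_natCast_atTop_atTop.atTop_mul_const hμ)).const_mul_atTop hα)
  have h := ((tendsto_Gamma_div_Gamma_add hα).comp hx).norm.mul_const ‖z‖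
  rw [norm_zero, zero_mul] at h
  refine summable_of_ratio_norm_eventually_le (r := 1 / 2) (by norm_num) ?_
  filter_upwards [h.eventually_le_const (show (0 : ℝ) < 1 / 2 by norm_num)] with i hi
  simp only [Function.comp] at hi
  rw [kilbasSaigoCoeff_succ, pow_succ, norm_norm, norm_norm,
    show α * (i * μ + l + 1) + 1 = α * (i * μ + l) + 1 + α by ring]
  push_cast
  rw [show ∀ a b c d : ℂ, a * b * (c * d) = a * c * (b * d) from fun _ _ _ _ => by ring, norm_mul,
    mul_comm]
  refine mul_le_mul_of_nonneg_right ?_ (norm_nonneg _)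
  rw [norm_mul]
  rwa [← Complex.ofReal_div, Complex.norm_real]

theorem dnAlpha_succ (γ : ℕ → ℝ) (k : ℕ) : dnAlpha γ (k + 1) = dnAlpha γ k + γ (k + 1) := by
  simp only [dnAlpha, Finset.sum_range_succ _ (k + 1)]
  ring

theorem dnAlpha_zero (γ : ℕ → ℝ) : dnAlpha γ 0 = γ 0 - 1 := by simp [dnAlpha]

theorem dnAlpha_lt {γ : ℕ → ℝ} {m : ℕ} (hγ : ∀ k ≤ m, 0 < γ k ∧ γ k ≤ 1) {j k : ℕ} (hjk : j < k)
    (hk : k ≤ m) : dnAlpha γ j < dnAlpha γ k := by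
  induction k, hjk using Nat.le_induction with
  | base => rw [dnAlpha_succ]; linarith [(hγ (j + 1) hk).1]
  | succ k hjk ih =>
    rw [dnAlpha_succ]
    linarith [(hγ (k + 1) hk).1, ih (by omega)]

theorem dnAlpha_le {γ : ℕ → ℝ} {m : ℕ} (hγ : ∀ k ≤ m, 0 < γ k ∧ γ k ≤ 1) {j k : ℕ} (hjk : j ≤ k)
    (hk : k ≤ m) : dnAlpha γ j ≤ dnAlpha γ k := by
  rcases hjk.eq_or_lt with rfl | h
  · exact le_rfl
  · exact (dnAlpha_lt hγ h hk).le

theorem dnAlpha_add_one_pos {γ : ℕ → ℝ} {m : ℕ} (hγ : ∀ k ≤ m, 0 < γ k ∧ γ k ≤ 1) {k : ℕ}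
    (hk : k ≤ m) : 0 < dnAlpha γ k + 1 := by
  have h := dnAlpha_le hγ (Nat.zero_le k) hk
  rw [dnAlpha_zero] at h
  linarith [(hγ 0 (Nat.zero_le m)).1]

/-- The exponents, raised by one, of `cauchyFormula` as a generalized power series over the pairs
`(k, i)`: the summand of index `k` contributes the powers `y^(α_k + i (α + s))`. -/
noncomputable def cauchyExp (γ : ℕ → ℝ) (m : ℕ) (s : ℝ) (p : Fin m × ℕ) : ℝ :=
  dnAlpha γ p.1 + 1 + p.2 * (dnAlpha γ m + s)

/-- The coefficients of `cauchyFormula` with respect to the kernels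
`rlKernel (cauchyExp γ m s p)`. -/
noncomputable def cauchyCoeff (γ : ℕ → ℝ) (m : ℕ) (s : ℝ) (lam : ℂ) (A : ℕ → ℂ)
    (p : Fin m × ℕ) : ℂ :=
  A p.1 * lam ^ p.2 * ((kilbasSaigoCoeff (dnAlpha γ m) ((dnAlpha γ m + s) / dnAlpha γ m)
    ((dnAlpha γ p.1 + s) / dnAlpha γ m) p.2 * Real.Gamma (cauchyExp γ m s p) /
      Real.Gamma (dnAlpha γ p.1 + 1) : ℝ) : ℂ)

/-- The coefficients of `cauchyFormula` without the leading powers `y^(α_k)`. -/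
noncomputable def cauchyTailCoeff (γ : ℕ → ℝ) (m : ℕ) (s : ℝ) (lam : ℂ) (A : ℕ → ℂ)
    (p : Fin m × ℕ) : ℂ :=
  if p.2 = 0 then 0 else cauchyCoeff γ m s lam A p

section

variable {γ : ℕ → ℝ} {m : ℕ} {s : ℝ}

theorem cauchyExp_pos (hγ : ∀ k ≤ m, 0 < γ k ∧ γ k ≤ 1) (hα : 0 < dnAlpha γ m) (hs : 0 ≤ s)
    (p : Fin m × ℕ) : 0 < cauchyExp γ m s p := by
  have := dnAlpha_add_one_pos hγ p.1.2.le
  unfold cauchyExp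
  positivity

theorem cauchyExp_succ (k : Fin m) (i : ℕ) :
    cauchyExp γ m s (k, i + 1) = cauchyExp γ m s (k, i) + dnAlpha γ m + s := by
  simp only [cauchyExp]
  push_cast
  ring

theorem cauchyCoeff_zero (hγ : ∀ k ≤ m, 0 < γ k ∧ γ k ≤ 1) (lam : ℂ) (A : ℕ → ℂ) (k : Fin m) :
    cauchyCoeff γ m s lam A (k, 0) = A k := by
  have := (Real.Gamma_pos_of_pos (dnAlpha_add_one_pos hγ k.2.le)).ne'
  simp [cauchyCoeff, cauchyExp, kilbasSaigoCoeff_zero, this]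

theorem cauchyCoeff_succ (hγ : ∀ k ≤ m, 0 < γ k ∧ γ k ≤ 1) (hα : 0 < dnAlpha γ m) (hs : 0 ≤ s)
    (lam : ℂ) (A : ℕ → ℂ) (k : Fin m) (i : ℕ) :
    cauchyCoeff γ m s lam A (k, i + 1) = lam * cauchyCoeff γ m s lam A (k, i) *
      ((Real.Gamma (cauchyExp γ m s (k, i) + s) / Real.Gamma (cauchyExp γ m s (k, i)) : ℝ) : ℂ) := by
  have h1 := cauchyExp_pos hγ hα hs (k, i)
  have h2 := (Real.Gamma_pos_of_pos h1).ne'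
  have h3 := (Real.Gamma_pos_of_pos (cauchyExp_pos hγ hα hs (k, i + 1))).ne'
  have e1 : dnAlpha γ m * (i * ((dnAlpha γ m + s) / dnAlpha γ m) +
      (dnAlpha γ k + s) / dnAlpha γ m) + 1 = cauchyExp γ m s (k, i) + s := by
    simp only [cauchyExp]
    field_simp
    ring
  have e2 : dnAlpha γ m * (i * ((dnAlpha γ m + s) / dnAlpha γ m) +
      (dnAlpha γ k + s) / dnAlpha γ m + 1) + 1 = cauchyExp γ m s (k, i + 1) := by
    rw [cauchyExp_succ]
    linear_combination e1
  simp only [cauchyCoeff]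
  rw [kilbasSaigoCoeff_succ, e1, e2, pow_succ]
  set c := kilbasSaigoCoeff (dnAlpha γ m) ((dnAlpha γ m + s) / dnAlpha γ m)
    ((dnAlpha γ k + s) / dnAlpha γ m) i
  have : c * (Real.Gamma (cauchyExp γ m s (k, i) + s) / Real.Gamma (cauchyExp γ m s (k, i + 1))) *
      Real.Gamma (cauchyExp γ m s (k, i + 1)) / Real.Gamma (dnAlpha γ k + 1) =
      c * Real.Gamma (cauchyExp γ m s (k, i)) / Real.Gamma (dnAlpha γ k + 1) *
      (Real.Gamma (cauchyExp γ m s (k, i) + s) / Real.Gamma (cauchyExp γ m s (k, i))) := by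
    field_simp
  rw [this]
  push_cast
  ring

theorem cauchyCoeff_mul_rlKernel (hγ : ∀ k ≤ m, 0 < γ k ∧ γ k ≤ 1) (hα : 0 < dnAlpha γ m)
    (hs : 0 ≤ s) (lam : ℂ) (A : ℕ → ℂ) (k : Fin m) (i : ℕ) {y : ℝ} (hy : 0 < y) :
    cauchyCoeff γ m s lam A (k, i) * (rlKernel (cauchyExp γ m s (k, i)) y : ℂ) =
      A k * ((y ^ dnAlpha γ k : ℝ) : ℂ) / (Real.Gamma (dnAlpha γ k + 1) : ℂ) *
      ((kilbasSaigoCoeff (dnAlpha γ m) ((dnAlpha γ m + s) / dnAlpha γ m)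
        ((dnAlpha γ k + s) / dnAlpha γ m) i : ℂ) *
          (lam * ((y ^ (dnAlpha γ m + s) : ℝ) : ℂ)) ^ i) := by
  have h2 : (Real.Gamma (cauchyExp γ m s (k, i)) : ℂ) ≠ 0 :=
    Complex.ofReal_ne_zero.2 (Real.Gamma_pos_of_pos (cauchyExp_pos hγ hα hs (k, i))).ne'
  rw [rlKernel_of_pos hy, mul_pow, ← Complex.ofReal_pow, ← Real.rpow_mul_natCast hy.le,
    show cauchyExp γ m s (k, i) - 1 = dnAlpha γ k + (dnAlpha γ m + s) * i by
      simp only [cauchyExp]; ring, Real.rpow_add hy]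
  simp only [cauchyCoeff]
  push_cast
  field_simp

theorem tendsto_cauchyExp (hγ : ∀ k ≤ m, 0 < γ k ∧ γ k ≤ 1) (hα : 0 < dnAlpha γ m)
    (hs : 0 ≤ s) : Tendsto (cauchyExp γ m s) cofinite atTop := by
  refine tendsto_atTop.2 fun M => ?_
  obtain ⟨N, hN⟩ := exists_nat_ge (M / (dnAlpha γ m + s))
  have hpos : 0 < dnAlpha γ m + s := by linarith
  rw [div_le_iff₀ hpos] at hN
  refine (Set.Finite.prod (Set.finite_univ (α := Fin m)) (Set.finite_lt_nat N)).subset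
    fun p hp => ⟨mem_univ _, ?_⟩
  by_contra hlt
  refine hp ?_
  have h1 : (N : ℝ) ≤ p.2 := by exact_mod_cast not_lt.1 hlt
  have h2 := mul_le_mul_of_nonneg_right h1 hpos.le
  have h3 := dnAlpha_add_one_pos hγ p.1.2.le
  change M ≤ cauchyExp γ m s p
  unfold cauchyExp
  linarith

theorem kernelSummable_cauchy (hγ : ∀ k ≤ m, 0 < γ k ∧ γ k ≤ 1) (hα : 0 < dnAlpha γ m)
    (hs : 0 ≤ s) (lam : ℂ) (A : ℕ → ℂ) :
    KernelSummable (cauchyCoeff γ m s lam A) (cauchyExp γ m s) := by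
  refine ⟨tendsto_cauchyExp hγ hα hs, fun y hy => ?_⟩
  have e : ∀ p, ‖cauchyCoeff γ m s lam A p‖ * |rlKernel (cauchyExp γ m s p) y| =
      ‖cauchyCoeff γ m s lam A p * (rlKernel (cauchyExp γ m s p) y : ℂ)‖ := by simp
  simp_rw [e]
  refine (summable_prod_of_nonneg fun p => norm_nonneg _).2 ⟨fun k => ?_, Summable.of_finite⟩
  simp_rw [cauchyCoeff_mul_rlKernel hγ hα hs lam A k _ hy]
  simp_rw [norm_mul (_ / _)]
  exact (summable_kilbasSaigo hα (by positivity) _ _).mul_left _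

theorem kernelSummable_cauchyTail (hγ : ∀ k ≤ m, 0 < γ k ∧ γ k ≤ 1) (hα : 0 < dnAlpha γ m)
    (hs : 0 ≤ s) (lam : ℂ) (A : ℕ → ℂ) :
    KernelSummable (cauchyTailCoeff γ m s lam A) (cauchyExp γ m s) := by
  refine (kernelSummable_cauchy hγ hα hs lam A).mono fun p => ?_
  unfold cauchyTailCoeff
  split_ifs <;> simp

theorem cauchyFormula_eq_kernelSeries (hγ : ∀ k ≤ m, 0 < γ k ∧ γ k ≤ 1) (hα : 0 < dnAlpha γ m)
    (hs : 0 ≤ s) (lam : ℂ) (A : ℕ → ℂ) {y : ℝ} (hy : 0 < y) :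
    cauchyFormula γ m s lam A y =
      kernelSeries (cauchyCoeff γ m s lam A) (cauchyExp γ m s) y := by
  rw [kernelSeries,
    ((kernelSummable_cauchy hγ hα hs lam A).summable_norm hy).of_norm.tsum_prod, tsum_fintype,
    cauchyFormula, Finset.sum_range]
  refine Finset.sum_congr rfl fun k _ => ?_
  simp_rw [cauchyCoeff_mul_rlKernel hγ hα hs lam A k _ hy]
  rw [tsum_mul_left, kilbasSaigo]

/-- The recursion of the Kilbas-Saigo coefficients: multiplying `cauchyFormula` by `lam * y^s`
amounts to dropping its leading powers and differentiating `α` times. -/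
theorem mul_cauchyFormula_eq_kernelSeries (hγ : ∀ k ≤ m, 0 < γ k ∧ γ k ≤ 1)
    (hα : 0 < dnAlpha γ m) (hs : 0 ≤ s) (lam : ℂ) (A : ℕ → ℂ) {y : ℝ} (hy : 0 < y) :
    lam * ((y ^ s : ℝ) : ℂ) * cauchyFormula γ m s lam A y =
      kernelSeries (cauchyTailCoeff γ m s lam A) (fun p => cauchyExp γ m s p - dnAlpha γ m) y := by
  have hsum := ((kernelSummable_cauchy hγ hα hs lam A).summable_norm hy).of_norm
  have hsum' := (((kernelSummable_cauchyTail hγ hα hs lam A).shift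
    (-dnAlpha γ m)).summable_norm hy).of_norm
  simp only [← sub_eq_add_neg] at hsum'
  rw [cauchyFormula_eq_kernelSeries hγ hα hs lam A hy, kernelSeries, kernelSeries,
    hsum.tsum_prod, hsum'.tsum_prod, tsum_fintype, tsum_fintype, Finset.mul_sum]
  refine Finset.sum_congr rfl fun k _ => ?_
  rw [(hsum'.prod_factor k).tsum_eq_zero_add, ← tsum_mul_left]
  simp only [cauchyTailCoeff, if_true, zero_mul, zero_add, Nat.succ_ne_zero, if_false]
  refine tsum_congr fun i => ?_
  have hq := cauchyExp_pos hγ hα hs (k, i)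
  have h1 := (Real.Gamma_pos_of_pos hq).ne'
  have h2 := (Real.Gamma_pos_of_pos (add_pos_of_pos_of_nonneg hq hs)).ne'
  rw [cauchyCoeff_succ hγ hα hs, cauchyExp_succ, rlKernel_of_pos hy, rlKernel_of_pos hy,
    show cauchyExp γ m s (k, i) + dnAlpha γ m + s - dnAlpha γ m = cauchyExp γ m s (k, i) + s by
      ring,
    show cauchyExp γ m s (k, i) + s - 1 = s + (cauchyExp γ m s (k, i) - 1) by ring,
    Real.rpow_add hy]
  have e : (Real.Gamma (cauchyExp γ m s (k, i) + s) / Real.Gamma (cauchyExp γ m s (k, i))) *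
      (y ^ s * y ^ (cauchyExp γ m s (k, i) - 1) / Real.Gamma (cauchyExp γ m s (k, i) + s)) =
      y ^ s * (y ^ (cauchyExp γ m s (k, i) - 1) / Real.Gamma (cauchyExp γ m s (k, i))) := by
    field_simp
  rw [mul_assoc (lam * _), ← Complex.ofReal_mul, e]
  push_cast
  ring

theorem continuousOn_cauchyFormula (hγ : ∀ k ≤ m, 0 < γ k ∧ γ k ≤ 1) (hα : 0 < dnAlpha γ m)
    (hs : 0 ≤ s) (lam : ℂ) (A : ℕ → ℂ) : ContinuousOn (cauchyFormula γ m s lam A) (Ioi 0) :=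
  (continuousOn_kernelSeries (kernelSummable_cauchy hγ hα hs lam A)).congr fun _ hy =>
    cauchyFormula_eq_kernelSeries hγ hα hs lam A hy

theorem cauchyExp_sub_pos_of_cauchyTailCoeff_ne_zero (hγ : ∀ k ≤ m, 0 < γ k ∧ γ k ≤ 1)
    (hα : 0 < dnAlpha γ m) (hs : 0 ≤ s) {lam : ℂ} {A : ℕ → ℂ} {p : Fin m × ℕ}
    (hp : cauchyTailCoeff γ m s lam A p ≠ 0) : 0 < cauchyExp γ m s p - dnAlpha γ m := by
  obtain ⟨k, i⟩ := p
  rcases i with _ | i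
  · simp [cauchyTailCoeff] at hp
  · rw [cauchyExp_succ]
    linarith [cauchyExp_pos hγ hα hs (k, i)]

/-- `cauchyFormula` solves the Volterra equation to which the Cauchy problem leads, whether or
not it solves the Cauchy problem itself. -/
theorem cauchyFormula_eq_add_fracInt (hγ : ∀ k ≤ m, 0 < γ k ∧ γ k ≤ 1) (hα : 0 < dnAlpha γ m)
    (hs : 0 ≤ s) (lam : ℂ) (A : ℕ → ℂ) {y : ℝ} (hy : 0 < y) :
    FracIntegrable (dnAlpha γ m)
      (fun t => lam * ((t ^ s : ℝ) : ℂ) * cauchyFormula γ m s lam A t) y ∧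
    cauchyFormula γ m s lam A y =
      ∑ k ∈ Finset.range m, A k * (rlKernel (dnAlpha γ k + 1) y : ℂ) +
      fracInt (dnAlpha γ m) (fun t => lam * ((t ^ s : ℝ) : ℂ) * cauchyFormula γ m s lam A t) y := by
  have hE : EqOn (fun t => lam * ((t ^ s : ℝ) : ℂ) * cauchyFormula γ m s lam A t)
      (kernelSeries (cauchyTailCoeff γ m s lam A) (fun p => cauchyExp γ m s p - dnAlpha γ m))
      (Ioi 0) := fun t ht => mul_cauchyFormula_eq_kernelSeries hγ hα hs lam A ht
  have hk := (kernelSummable_cauchyTail hγ hα hs lam A).shift (-dnAlpha γ m)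
  simp only [← sub_eq_add_neg] at hk
  obtain ⟨h1, h2⟩ := fracInt_kernelSeries hk
    (fun p => cauchyExp_sub_pos_of_cauchyTailCoeff_ne_zero hγ hα hs) hα hy
  refine ⟨(fracIntegrable_congr hE).2 h1, ?_⟩
  have hsum := ((kernelSummable_cauchy hγ hα hs lam A).summable_norm hy).of_norm
  have hsum' := ((kernelSummable_cauchyTail hγ hα hs lam A).summable_norm hy).of_norm
  rw [fracInt_congr hE, h2, cauchyFormula_eq_kernelSeries hγ hα hs lam A hy, kernelSeries,
    kernelSeries]
  simp only [sub_add_cancel]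
  rw [hsum.tsum_prod, hsum'.tsum_prod, tsum_fintype, tsum_fintype, Finset.sum_range,
    ← Finset.sum_add_distrib]
  refine Finset.sum_congr rfl fun k _ => ?_
  rw [(hsum.prod_factor k).tsum_eq_zero_add, (hsum'.prod_factor k).tsum_eq_zero_add]
  simp only [cauchyTailCoeff, if_true, zero_mul, zero_add, Nat.succ_ne_zero, if_false,
    cauchyCoeff_zero hγ]
  simp [cauchyExp]

end

/-! ### The formula solves the Cauchy problem -/

/-- The operator `D^(γ - 1)` is defined on kernel series with integrable terms and raises all
exponents by `1 - γ`. -/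
theorem rlD_kernelSeries {ι : Type*} [Countable ι] {b : ι → ℂ} {q : ι → ℝ}
    (h : KernelSummable b q) (hq : ∀ i, b i ≠ 0 → 0 < q i) {γ : ℝ} (h1 : γ ≤ 1)
    {g : ℝ → ℂ} (hg : EqOn g (kernelSeries b q) (Ioi 0)) :
    RLDefined (γ - 1) g ∧
      EqOn (rlD (γ - 1) g) (kernelSeries b fun i => q i + (1 - γ)) (Ioi 0) := by
  rcases h1.eq_or_lt with rfl | h1
  · refine ⟨fun h => by norm_num at h, ?_⟩
    rw [rlD_one_sub_one]
    simpa using hg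
  · have ha : 0 < 1 - γ := by linarith
    refine ⟨(rlDefined_iff h1 g).2 fun y hy => ?_, fun y hy => ?_⟩
    · exact (fracIntegrable_congr hg).2 (fracInt_kernelSeries h hq ha hy).1
    · rw [rlD_sub_one_of_lt h1 hy, fracInt_congr hg, (fracInt_kernelSeries h hq ha hy).2]

/-- The coefficients of `cauchyFormula` without the leading powers `y^(α_k)`, `k < j`. -/
noncomputable def cauchyCutCoeff (γ : ℕ → ℝ) (m : ℕ) (s : ℝ) (lam : ℂ) (A : ℕ → ℂ) (j : ℕ)
    (p : Fin m × ℕ) : ℂ :=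
  if p.2 = 0 ∧ (p.1 : ℕ) < j then 0 else cauchyCoeff γ m s lam A p

section

variable {γ : ℕ → ℝ} {m : ℕ} {s : ℝ} {lam : ℂ} {A : ℕ → ℂ}

theorem cauchyCutCoeff_zero : cauchyCutCoeff γ m s lam A 0 = cauchyCoeff γ m s lam A := by
  ext p
  simp [cauchyCutCoeff]

theorem cauchyCutCoeff_self : cauchyCutCoeff γ m s lam A m = cauchyTailCoeff γ m s lam A := by
  ext p
  simp [cauchyCutCoeff, cauchyTailCoeff]

theorem kernelSummable_cauchyCut (hγ : ∀ k ≤ m, 0 < γ k ∧ γ k ≤ 1) (hα : 0 < dnAlpha γ m)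
    (hs : 0 ≤ s) (j : ℕ) (r : ℝ) :
    KernelSummable (cauchyCutCoeff γ m s lam A j) fun p => cauchyExp γ m s p - r := by
  simp only [sub_eq_add_neg]
  refine KernelSummable.shift ((kernelSummable_cauchy hγ hα hs lam A).mono fun p => ?_) _
  unfold cauchyCutCoeff
  split_ifs <;> simp

/-- Under the compatibility condition, the terms of `cauchyFormula` other than the leading powers
are of higher order at the origin than `y^(α_j)`, `j < m`. -/
theorem lt_cauchyExp (hγ : ∀ k ≤ m, 0 < γ k ∧ γ k ≤ 1) (hα : 0 < dnAlpha γ m) (hs : 0 ≤ s)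
    (hA : lam ≠ 0 → ∀ k < m, A k ≠ 0 → dnAlpha γ (m - 1) < dnAlpha γ m + s + dnAlpha γ k)
    {j : ℕ} (hj : j < m) {k : Fin m} {i : ℕ} (hb : cauchyCoeff γ m s lam A (k, i + 1) ≠ 0) :
    dnAlpha γ j + 1 < cauchyExp γ m s (k, i + 1) := by
  have hAk : A k ≠ 0 := fun h => hb (by simp [cauchyCoeff, h])
  have hl : lam ≠ 0 := fun h => hb (by simp [cauchyCoeff, h])
  have h1 := hA hl k k.2 hAk
  have h2 := dnAlpha_le hγ (show j ≤ m - 1 by omega) (Nat.sub_le m 1)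
  have h3 : 0 ≤ (i : ℝ) * (dnAlpha γ m + s) := by positivity
  simp only [cauchyExp]
  push_cast
  linarith

theorem one_le_cauchyExp_sub (hγ : ∀ k ≤ m, 0 < γ k ∧ γ k ≤ 1) (hα : 0 < dnAlpha γ m)
    (hs : 0 ≤ s)
    (hA : lam ≠ 0 → ∀ k < m, A k ≠ 0 → dnAlpha γ (m - 1) < dnAlpha γ m + s + dnAlpha γ k)
    {j : ℕ} (hj : j < m) {p : Fin m × ℕ} (hp : cauchyCutCoeff γ m s lam A j p ≠ 0) :
    1 ≤ cauchyExp γ m s p - dnAlpha γ j := by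
  obtain ⟨k, i⟩ := p
  rcases i with _ | i
  · have hjk : j ≤ k := by
      by_contra h
      exact hp (by simp [cauchyCutCoeff, not_le.1 h])
    have := dnAlpha_le hγ hjk k.2.le
    simp only [cauchyExp]
    push_cast
    linarith
  · have := lt_cauchyExp hγ hα hs hA hj (k := k) (i := i) (by simpa [cauchyCutCoeff] using hp)
    linarith

theorem cauchyExp_sub_pos (hγ : ∀ k ≤ m, 0 < γ k ∧ γ k ≤ 1) (hα : 0 < dnAlpha γ m)
    (hs : 0 ≤ s)
    (hA : lam ≠ 0 → ∀ k < m, A k ≠ 0 → dnAlpha γ (m - 1) < dnAlpha γ m + s + dnAlpha γ k)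
    {j : ℕ} (hj : j < m) {p : Fin m × ℕ} (hp : cauchyCutCoeff γ m s lam A (j + 1) p ≠ 0) :
    0 < cauchyExp γ m s p - (dnAlpha γ j + 1) := by
  obtain ⟨k, i⟩ := p
  rcases i with _ | i
  · have hjk : j < k := by
      by_contra h
      exact hp (by simp [cauchyCutCoeff, not_lt.1 h])
    have := dnAlpha_lt hγ hjk k.2.le
    simp only [cauchyExp]
    push_cast
    linarith
  · have := lt_cauchyExp hγ hα hs hA hj (k := k) (i := i) (by simpa [cauchyCutCoeff] using hp)
    linarith

/-- Differentiation kills the constant term, that is, the power of index `(j, 0)`. -/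
theorem kernelSeries_cauchyCut_succ {j : ℕ} {y : ℝ} (hy : 0 < y) :
    kernelSeries (cauchyCutCoeff γ m s lam A j)
      (fun p => cauchyExp γ m s p - dnAlpha γ j - 1) y =
    kernelSeries (cauchyCutCoeff γ m s lam A (j + 1))
      (fun p => cauchyExp γ m s p - (dnAlpha γ j + 1)) y := by
  refine tsum_congr fun p => ?_
  simp only [sub_sub]
  by_cases h : p.2 = 0 ∧ (p.1 : ℕ) = j
  · have : cauchyExp γ m s p - (dnAlpha γ j + 1) = 0 := by simp [cauchyExp, h.1, h.2]
    rw [this, rlKernel_of_pos hy]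
    simp
  · congr 1
    have : (p.2 = 0 ∧ (p.1 : ℕ) < j) ↔ (p.2 = 0 ∧ (p.1 : ℕ) < j + 1) := by
      constructor <;> rintro ⟨h1, h2⟩ <;> refine ⟨h1, ?_⟩ <;> grind
    simp only [cauchyCutCoeff, this]

/-- The constant term of `D^{α_j}` applied to the formula. -/
theorem tsum_cauchyCut (hγ : ∀ k ≤ m, 0 < γ k ∧ γ k ≤ 1) (hα : 0 < dnAlpha γ m)
    (hs : 0 ≤ s)
    (hA : lam ≠ 0 → ∀ k < m, A k ≠ 0 → dnAlpha γ (m - 1) < dnAlpha γ m + s + dnAlpha γ k)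
    {j : ℕ} (hj : j < m) :
    ∑' p, (if cauchyExp γ m s p - dnAlpha γ j = 1 then cauchyCutCoeff γ m s lam A j p else 0) =
      A j := by
  rw [tsum_eq_single (⟨j, hj⟩, 0)]
  · rw [if_pos (by simp [cauchyExp])]
    simp [cauchyCutCoeff, cauchyCoeff_zero hγ]
  · rintro ⟨k, i⟩ hne
    rw [ite_eq_right_iff]
    intro h1
    by_contra hp
    rcases i with _ | i
    · have hjk : j ≤ k := by
        by_contra h
        exact hp (by simp [cauchyCutCoeff, not_le.1 h])
      have hjk' : j ≠ k := fun h => hne (by simp [h])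
      have := dnAlpha_lt hγ (lt_of_le_of_ne hjk hjk') k.2.le
      simp only [cauchyExp] at h1
      push_cast at h1
      linarith
    · have := lt_cauchyExp hγ hα hs hA hj (k := k) (i := i) (by simpa [cauchyCutCoeff] using hp)
      linarith

theorem hasDerivAt_of_eqOn_kernelSeries {ι : Type*} {b : ι → ℂ} {q : ι → ℝ}
    (h : KernelSummable b q) {g : ℝ → ℂ} (hg : EqOn g (kernelSeries b q) (Ioi 0)) {y : ℝ}
    (hy : 0 < y) : HasDerivAt g (kernelSeries b (fun i => q i - 1) y) y :=
  (hasDerivAt_kernelSeries h hy).congr_of_eventuallyEq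
    (hg.eventuallyEq_of_mem (Ioi_mem_nhds hy))

theorem isCauchySolution_cauchyFormula (hγ : ∀ k ≤ m, 0 < γ k ∧ γ k ≤ 1)
    (hα : 0 < dnAlpha γ m) (hs : 0 ≤ s)
    (hA : lam ≠ 0 → ∀ k < m, A k ≠ 0 → dnAlpha γ (m - 1) < dnAlpha γ m + s + dnAlpha γ k) :
    IsCauchySolution γ m s lam A (cauchyFormula γ m s lam A) := by
  set U := cauchyFormula γ m s lam A with hU
  have hks := fun j r => kernelSummable_cauchyCut (lam := lam) (A := A) hγ hα hs j r
  have h0 := rlD_kernelSeries (γ := γ 0) (kernelSummable_cauchy hγ hα hs lam A)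
    (fun p _ => cauchyExp_pos hγ hα hs p) (hγ 0 (Nat.zero_le m)).2
    (g := U) fun y hy => cauchyFormula_eq_kernelSeries hγ hα hs lam A hy
  -- one step of the recursion for the operators `D^{α_j}`
  have hderiv : ∀ j < m, EqOn (dnAlphaOp γ j U) (kernelSeries (cauchyCutCoeff γ m s lam A j)
      fun p => cauchyExp γ m s p - dnAlpha γ j) (Ioi 0) →
      EqOn (deriv (dnAlphaOp γ j U)) (kernelSeries (cauchyCutCoeff γ m s lam A (j + 1))
      fun p => cauchyExp γ m s p - (dnAlpha γ j + 1)) (Ioi 0) := fun j hj ih y hy => by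
    rw [(hasDerivAt_of_eqOn_kernelSeries (hks j _) ih hy).deriv, kernelSeries_cauchyCut_succ hy]
  have hstep : ∀ j < m, EqOn (dnAlphaOp γ j U) (kernelSeries (cauchyCutCoeff γ m s lam A j)
      fun p => cauchyExp γ m s p - dnAlpha γ j) (Ioi 0) →
      RLDefined (γ (j + 1) - 1) (deriv (dnAlphaOp γ j U)) ∧
      EqOn (dnAlphaOp γ (j + 1) U) (kernelSeries (cauchyCutCoeff γ m s lam A (j + 1))
      fun p => cauchyExp γ m s p - dnAlpha γ (j + 1)) (Ioi 0) := fun j hj ih => by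
    obtain ⟨h1, h2⟩ := rlD_kernelSeries (γ := γ (j + 1)) (hks (j + 1) (dnAlpha γ j + 1))
      (fun p => cauchyExp_sub_pos hγ hα hs hA hj) (hγ (j + 1) hj).2 (hderiv j hj ih)
    refine ⟨h1, fun y hy => (h2 hy).trans ?_⟩
    congr 1
    ext p
    rw [dnAlpha_succ]
    ring
  have key : ∀ j ≤ m, EqOn (dnAlphaOp γ j U) (kernelSeries (cauchyCutCoeff γ m s lam A j)
      fun p => cauchyExp γ m s p - dnAlpha γ j) (Ioi 0) := by
    intro j
    induction j with
    | zero =>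
      intro _ y hy
      refine (h0.2 hy).trans ?_
      rw [cauchyCutCoeff_zero]
      congr 1
      ext p
      rw [dnAlpha_zero]
      ring
    | succ j ih => exact fun hj => (hstep j hj (ih (by omega))).2
  refine ⟨⟨h0.1, fun k hk y hy => ?_, fun k hk => (hstep k hk (key k hk.le)).1⟩,
    fun y hy => ?_, fun k hk => ?_⟩
  · exact (hasDerivAt_of_eqOn_kernelSeries (hks k _) (key k hk.le) hy).differentiableAt
  · rw [dnOp_eq_dnAlphaOp hγ U m le_rfl, key m le_rfl hy, cauchyCutCoeff_self, hU,
      mul_cauchyFormula_eq_kernelSeries hγ hα hs lam A hy]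
  · have h := tendsto_kernelSeries_zero (hks k (dnAlpha γ k))
      fun p => one_le_cauchyExp_sub hγ hα hs hA hk
    rw [tsum_cauchyCut hγ hα hs hA hk] at h
    exact h.congr' ((key k hk.le).symm.eventuallyEq_of_mem self_mem_nhdsWithin)

end

/-! ### Uniqueness for the Volterra equation -/

theorem lintegral_exp_mul_rlKernel {a κ : ℝ} (ha : 0 < a) (hκ : 0 < κ) :
    ∫⁻ x, ENNReal.ofReal (Real.exp (-(κ * x)) * rlKernel a x) = ENNReal.ofReal ((1 / κ) ^ a) := by
  have hΓ := Real.Gamma_pos_of_pos ha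
  have e : (fun x => Real.exp (-(κ * x)) * rlKernel a x) = (Ioi 0).indicator fun x =>
      x ^ (a - 1) * Real.exp (-(κ * x)) / Real.Gamma a := by
    ext x
    by_cases hx : 0 < x
    · rw [indicator_of_mem (show x ∈ Ioi 0 from hx), rlKernel_of_pos hx]
      ring
    · rw [indicator_of_notMem (show x ∉ Ioi 0 from hx), rlKernel_of_nonpos (not_lt.1 hx), mul_zero]
  have hval := Real.integral_rpow_mul_exp_neg_mul_Ioi ha hκ
  have hI : ∫ x, Real.exp (-(κ * x)) * rlKernel a x = (1 / κ) ^ a := by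
    rw [e, integral_indicator measurableSet_Ioi, integral_div, hval]
    field_simp
  have hint : Integrable fun x => Real.exp (-(κ * x)) * rlKernel a x := by
    refine not_imp_comm.1 integral_undef ?_
    rw [hI]
    positivity
  rw [← hI, ofReal_integral_eq_lintegral_ofReal hint]
  exact .of_forall fun x => mul_nonneg (Real.exp_pos _).le (rlKernel_nonneg ha x)

/-- A weighted `L¹` estimate (Bielecki's method): fractional integration has norm at most `κ^(-a)`
with respect to the weight `exp (-κ y)`. -/
theorem lintegral_exp_mul_lintegral_rlKernel_le {a κ T : ℝ} (ha : 0 < a) (hκ : 0 < κ)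
    {f : ℝ → ENNReal} (hf : AEMeasurable f (volume.restrict (Ioo 0 T))) :
    ∫⁻ y in Ioo 0 T, ENNReal.ofReal (Real.exp (-(κ * y))) *
        ∫⁻ t in Ioo 0 T, ENNReal.ofReal (rlKernel a (y - t)) * f t ≤
      ENNReal.ofReal ((1 / κ) ^ a) *
        ∫⁻ t in Ioo 0 T, ENNReal.ofReal (Real.exp (-(κ * t))) * f t := by
  have hK := measurable_rlKernel a
  have e1 : ∀ y, ENNReal.ofReal (Real.exp (-(κ * y))) *
      ∫⁻ t in Ioo 0 T, ENNReal.ofReal (rlKernel a (y - t)) * f t =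
      ∫⁻ t in Ioo 0 T, ENNReal.ofReal (Real.exp (-(κ * (y - t))) * rlKernel a (y - t)) *
        (ENNReal.ofReal (Real.exp (-(κ * t))) * f t) := fun y => by
    rw [← lintegral_const_mul' _ _ ENNReal.ofReal_ne_top]
    refine lintegral_congr fun t => ?_
    rw [← mul_assoc, ← mul_assoc, ← ENNReal.ofReal_mul (Real.exp_pos _).le,
      ← ENNReal.ofReal_mul (mul_nonneg (Real.exp_pos _).le (rlKernel_nonneg ha _)),
      mul_right_comm, ← Real.exp_add]
    ring_nf
  have hm : AEMeasurable (Function.uncurry fun y t : ℝ =>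
      ENNReal.ofReal (Real.exp (-(κ * (y - t))) * rlKernel a (y - t)) *
        (ENNReal.ofReal (Real.exp (-(κ * t))) * f t))
      ((volume.restrict (Ioo 0 T)).prod (volume.restrict (Ioo 0 T))) := by
    refine AEMeasurable.mul ?_ (AEMeasurable.mul ?_ hf.comp_snd)
    · exact Measurable.aemeasurable (by fun_prop)
    · exact Measurable.aemeasurable (by fun_prop)
  simp_rw [e1]
  rw [lintegral_lintegral_swap hm, ← lintegral_const_mul' _ _ ENNReal.ofReal_ne_top]
  refine lintegral_mono fun t => ?_
  rw [lintegral_mul_const _ (by fun_prop)]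
  gcongr
  refine (setLIntegral_le_lintegral _ _).trans_eq ?_
  rw [lintegral_sub_right_eq_self
    (fun x => ENNReal.ofReal (Real.exp (-(κ * x)) * rlKernel a x)) t,
    lintegral_exp_mul_rlKernel ha hκ]

theorem enorm_fracInt_le {a y T : ℝ} (ha : 0 < a) (hy : y < T) (f : ℝ → ℂ) :
    ‖fracInt a f y‖ₑ ≤ ∫⁻ t in Ioo 0 T, ENNReal.ofReal (rlKernel a (y - t)) * ‖f t‖ₑ := by
  have h : fracInt a f y = ∫ t in Ioo 0 T, (rlKernel a (y - t) : ℂ) * f t := by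
    rw [fracInt, ← Ioi_inter_Iio, ← setIntegral_indicator measurableSet_Iio]
    refine integral_congr_ae (.of_forall fun t => ?_)
    by_cases ht : t < T
    · simp [indicator_of_mem (show t ∈ Iio T from ht)]
    · simp only [indicator_of_notMem (show t ∉ Iio T from ht)]
      rw [rlKernel_of_nonpos (by linarith [not_lt.1 ht])]
      simp
  rw [h]
  refine (enorm_integral_le_lintegral_enorm _).trans_eq (lintegral_congr fun t => ?_)
  rw [enorm_mul, ← ofReal_norm, Complex.norm_real,
    Real.norm_of_nonneg (rlKernel_nonneg ha _)]

theorem Ioi_zero_eq_iUnion_Ioo : Ioi (0 : ℝ) = ⋃ n : ℕ, Ioo 0 (n : ℝ) := by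
  ext x
  simp only [mem_Ioi, mem_iUnion, mem_Ioo, exists_and_left]
  exact ⟨fun hx => ⟨hx, exists_nat_gt x⟩, fun hx => hx.1⟩

/-- Uniqueness for the homogeneous Volterra equation in the locally integrable functions. -/
theorem ae_eq_zero_of_eq_fracInt {a s : ℝ} (ha : 0 < a) (hs : 0 ≤ s) (lam : ℂ) {v : ℝ → ℂ}
    (hv : ∀ T, IntegrableOn v (Ioo 0 T))
    (h : ∀ᵐ y ∂(volume.restrict (Ioi (0 : ℝ))),
      v y = fracInt a (fun t => lam * ((t ^ s : ℝ) : ℂ) * v t) y) :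
    ∀ᵐ y ∂(volume.restrict (Ioi (0 : ℝ))), v y = 0 := by
  rw [Ioi_zero_eq_iUnion_Ioo, ae_restrict_iUnion_iff]
  intro n
  set T : ℝ := (n : ℝ)
  rcases le_or_gt T 0 with hT | hT
  · simp [Ioo_eq_empty_of_le hT]
  set C : ℝ := ‖lam‖ * T ^ s with hC
  have hC0 : 0 ≤ C := by positivity
  -- `κ` is so large that the operator has norm at most `1 / 2` for the weighted norm
  set κ : ℝ := (2 * C + 1) ^ (1 / a) with hκdef
  have hκ : 0 < κ := by positivity
  have hκa : C * (1 / κ) ^ a ≤ 1 / 2 := by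
    rw [Real.div_rpow zero_le_one hκ.le, Real.one_rpow, hκdef, ← Real.rpow_mul (by positivity),
      one_div_mul_cancel ha.ne', Real.rpow_one, mul_one_div, div_le_div_iff₀ (by positivity)
      (by norm_num)]
    linarith
  have hvm : AEMeasurable (fun t => ‖v t‖ₑ) (volume.restrict (Ioo 0 T)) := (hv T).1.enorm
  set I := ∫⁻ y in Ioo 0 T, ENNReal.ofReal (Real.exp (-(κ * y))) * ‖v y‖ₑ with hI
  have hIfin : I ≠ ⊤ := by
    refine ((lintegral_mono_ae ?_).trans_lt (hv T).2).ne
    filter_upwards [ae_restrict_mem measurableSet_Ioo] with y hy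
    refine mul_le_of_le_one_left (zero_le) (ENNReal.ofReal_le_one.2 ?_)
    exact Real.exp_le_one_iff.2 (neg_nonpos.2 (mul_nonneg hκ.le hy.1.le))
  have hle : I ≤ ENNReal.ofReal (1 / 2) * I := by
    calc I ≤ ∫⁻ y in Ioo 0 T, ENNReal.ofReal (Real.exp (-(κ * y))) *
            ∫⁻ t in Ioo 0 T, ENNReal.ofReal (rlKernel a (y - t)) *
              (ENNReal.ofReal C * ‖v t‖ₑ) := by
          refine lintegral_mono_ae ?_
          filter_upwards [ae_restrict_mem measurableSet_Ioo,
            ae_restrict_of_ae_restrict_of_subset Ioo_subset_Ioi_self h] with y hy hvy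
          refine mul_le_mul_right ?_ _
          rw [hvy]
          refine (enorm_fracInt_le ha hy.2 _).trans (lintegral_mono_ae ?_)
          filter_upwards [ae_restrict_mem measurableSet_Ioo] with t ht
          refine mul_le_mul_right ?_ _
          rw [enorm_mul]
          refine mul_le_mul_left ?_ _
          rw [← ofReal_norm, norm_mul, Complex.norm_real,
            Real.norm_of_nonneg (Real.rpow_nonneg ht.1.le _)]
          exact ENNReal.ofReal_le_ofReal (mul_le_mul_of_nonneg_left
            (Real.rpow_le_rpow ht.1.le ht.2.le hs) (norm_nonneg _))
      _ ≤ ENNReal.ofReal ((1 / κ) ^ a) *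
            ∫⁻ t in Ioo 0 T, ENNReal.ofReal (Real.exp (-(κ * t))) * (ENNReal.ofReal C * ‖v t‖ₑ) :=
          lintegral_exp_mul_lintegral_rlKernel_le ha hκ (hvm.const_mul _)
      _ = ENNReal.ofReal (C * (1 / κ) ^ a) * I := by
          simp_rw [mul_left_comm _ (ENNReal.ofReal C)]
          rw [lintegral_const_mul' _ _ ENNReal.ofReal_ne_top, ← mul_assoc,
            ENNReal.ofReal_mul hC0, mul_comm (ENNReal.ofReal C)]
      _ ≤ _ := mul_le_mul_left (ENNReal.ofReal_le_ofReal hκa) _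
  have hI0 : I = 0 := by
    by_contra hne
    have h1 : ENNReal.ofReal (1 / 2) * I < 1 * I :=
      ENNReal.mul_lt_mul_left hne hIfin (by rw [ENNReal.ofReal_lt_one]; norm_num)
    rw [one_mul] at h1
    exact absurd hle h1.not_ge
  have hmI : AEMeasurable (fun y => ENNReal.ofReal (Real.exp (-(κ * y))) * ‖v y‖ₑ)
      (volume.restrict (Ioo 0 T)) :=
    AEMeasurable.mul (Measurable.aemeasurable (by fun_prop)) hvm
  filter_upwards [(lintegral_eq_zero_iff' hmI).1 hI0] with y hy
  simpa [(Real.exp_pos _).not_ge] using hy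

/-- By the Lebesgue differentiation theorem, a function is determined by its integrals over the
intervals `(0, y)`. -/
theorem ae_eq_zero_of_fracInt_one_eq_zero {v : ℝ → ℂ} (hv : ∀ T, IntegrableOn v (Ioo 0 T))
    (h : ∀ y, 0 < y → fracInt 1 v y = 0) : ∀ᵐ y ∂(volume.restrict (Ioi (0 : ℝ))), v y = 0 := by
  have hloc : ∀ n : ℕ, ∀ᵐ x : ℝ, x ∈ uIcc 0 (n : ℝ) → ∀ c ∈ uIcc 0 (n : ℝ),
      HasDerivAt (fun x => ∫ t in c..x, v t) (v x) x := fun n =>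
    IntervalIntegrable.ae_hasDerivAt_integral
      ((intervalIntegrable_iff_integrableOn_Ioo_of_le n.cast_nonneg).2 (hv n))
  rw [ae_restrict_iff' measurableSet_Ioi]
  filter_upwards [ae_all_iff.2 hloc] with x hx hx0
  obtain ⟨n, hn⟩ := exists_nat_gt x
  rw [mem_Ioi] at hx0
  have hd := hx n (by rw [uIcc_of_le n.cast_nonneg]; exact ⟨hx0.le, hn.le⟩) 0 left_mem_uIcc
  refine hd.unique ((hasDerivAt_const x (0 : ℂ)).congr_of_eventuallyEq ?_)
  filter_upwards [lt_mem_nhds hx0] with y hy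
  rw [← fracInt_one hy.le, h y hy]

/-! ### From the Cauchy problem to the Volterra equation -/

theorem aestronglyMeasurable_of_integrableOn_Ioo {g : ℝ → ℂ}
    (hg : ∀ T, IntegrableOn g (Ioo 0 T)) : AEStronglyMeasurable g (volume.restrict (Ioi 0)) := by
  rw [Ioi_zero_eq_iUnion_Ioo, aestronglyMeasurable_iUnion_iff]
  exact fun n => (hg n).1

/-- For orders in `(0, 1]` the kernel is bounded below on `(0, y)`. -/
theorem integrableOn_of_fracIntegrable {a y : ℝ} (ha : 0 < a) (ha1 : a ≤ 1) {g : ℝ → ℂ}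
    (h : FracIntegrable a g y) : IntegrableOn g (Ioo 0 y) := by
  rw [fracIntegrable_iff] at h
  have hΓ := Real.Gamma_pos_of_pos ha
  have hb := Integrable.bdd_mul (c := y ^ (1 - a) * Real.Gamma a) h
    (f := fun t => (((y - t) ^ (1 - a) * Real.Gamma a : ℝ) : ℂ))
    (Measurable.aestronglyMeasurable (by fun_prop)) (by
      filter_upwards [ae_restrict_mem measurableSet_Ioo] with t ht
      have h1 : 0 ≤ y - t := by linarith [ht.2]
      rw [Complex.norm_real, Real.norm_of_nonneg (by positivity)]
      have := Real.rpow_le_rpow h1 (by linarith [ht.1] : y - t ≤ y) (sub_nonneg.2 ha1)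
      gcongr)
  refine (integrable_congr ?_).1 hb
  filter_upwards [ae_restrict_mem measurableSet_Ioo] with t ht
  have h1 : 0 < y - t := by linarith [ht.2]
  have e : (y - t) ^ (1 - a) * Real.Gamma a * ((y - t) ^ (a - 1) / Real.Gamma a) = 1 := by
    rw [mul_assoc, mul_div_cancel₀ _ hΓ.ne', ← Real.rpow_add h1]
    simp
  rw [← mul_assoc, ← Complex.ofReal_mul, e]
  simp

theorem exists_norm_le_of_tendsto {g : ℝ → ℂ} {l : ℂ} (hc : ContinuousOn g (Ioi 0))
    (hl : Tendsto g (𝓝[>] 0) (𝓝 l)) (T : ℝ) : ∃ C, ∀ t ∈ Ioo 0 T, ‖g t‖ ≤ C := by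
  have h1 : ∀ᶠ t in 𝓝[>] (0 : ℝ), ‖g t‖ ≤ ‖l‖ + 1 :=
    hl.norm.eventually_le_const (lt_add_one _)
  obtain ⟨δ, hδ, hs⟩ := mem_nhdsGT_iff_exists_Ioo_subset.1 h1
  obtain ⟨C, hC⟩ := (isCompact_Icc (a := δ) (b := T)).exists_bound_of_continuousOn
    (hc.mono fun t ht => hδ.trans_le ht.1)
  refine ⟨max (‖l‖ + 1) C, fun t ht => ?_⟩
  rcases lt_or_ge t δ with h | h
  · exact le_max_of_le_left (hs ⟨ht.1, h⟩)
  · exact le_max_of_le_right (hC t ⟨h, ht.2.le⟩)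

theorem integrableOn_of_tendsto {g : ℝ → ℂ} {l : ℂ} (hc : ContinuousOn g (Ioi 0))
    (hl : Tendsto g (𝓝[>] 0) (𝓝 l)) (T : ℝ) : IntegrableOn g (Ioo 0 T) := by
  obtain ⟨C, hC⟩ := exists_norm_le_of_tendsto hc hl T
  exact (integrableOn_const (C := C) measure_Ioo_lt_top.ne).mono'
    ((hc.mono Ioo_subset_Ioi_self).aestronglyMeasurable measurableSet_Ioo)
    ((ae_restrict_iff' measurableSet_Ioo).2 (.of_forall hC))

theorem fracIntegrable_of_tendsto {g : ℝ → ℂ} {l : ℂ} (hc : ContinuousOn g (Ioi 0))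
    (hl : Tendsto g (𝓝[>] 0) (𝓝 l)) {a : ℝ} (ha : 0 < a) (y : ℝ) : FracIntegrable a g y := by
  obtain ⟨C, hC⟩ := exists_norm_le_of_tendsto hc hl y
  have h1 := ((integrable_rlKernel_conv_zero ha one_pos y).integrableOn (s := Ioi 0)).ofReal
    (𝕜 := ℂ) |>.norm.const_mul C
  refine h1.mono' ?_ ?_
  · have hK := measurable_rlKernel a
    refine AEStronglyMeasurable.mul (Measurable.aestronglyMeasurable (by fun_prop)) ?_
    exact hc.aestronglyMeasurable measurableSet_Ioi
  · filter_upwards [ae_restrict_mem measurableSet_Ioi] with t ht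
    rw [rlKernel_one_of_pos ht, mul_one, norm_mul, mul_comm]
    rcases lt_or_ge t y with h | h
    · exact mul_le_mul_of_nonneg_right (hC t ⟨ht, h⟩) (norm_nonneg _)
    · rw [rlKernel_of_nonpos (by linarith)]
      simp

theorem fracIntegrable_of_one_le {g : ℝ → ℂ} {a y : ℝ} (ha : 1 ≤ a)
    (hg : IntegrableOn g (Ioo 0 y)) : FracIntegrable a g y := by
  have hΓ := Real.Gamma_pos_of_pos (one_pos.trans_le ha)
  rw [fracIntegrable_iff]
  refine Integrable.bdd_mul (c := y ^ (a - 1) / Real.Gamma a) hg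
    (Measurable.aestronglyMeasurable (by fun_prop)) ?_
  filter_upwards [ae_restrict_mem measurableSet_Ioo] with t ht
  have h1 : 0 ≤ y - t := by linarith [ht.2]
  rw [Complex.norm_real, Real.norm_of_nonneg (by positivity)]
  have := Real.rpow_le_rpow h1 (by linarith [ht.1] : y - t ≤ y) (sub_nonneg.2 ha)
  gcongr

theorem integrableOn_rpow_mul {g : ℝ → ℂ} {s : ℝ} (hs : 0 ≤ s) (lam : ℂ) {T : ℝ}
    (hg : IntegrableOn g (Ioo 0 T)) :
    IntegrableOn (fun t => lam * ((t ^ s : ℝ) : ℂ) * g t) (Ioo 0 T) := by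
  refine Integrable.bdd_mul (c := ‖lam‖ * T ^ s) hg
    (Measurable.aestronglyMeasurable (by fun_prop)) ?_
  filter_upwards [ae_restrict_mem measurableSet_Ioo] with t ht
  rw [norm_mul, Complex.norm_real, Real.norm_of_nonneg (Real.rpow_nonneg ht.1.le _)]
  exact mul_le_mul_of_nonneg_left (Real.rpow_le_rpow ht.1.le ht.2.le hs) (norm_nonneg _)

theorem integrableOn_fracInt {g : ℝ → ℂ} {a : ℝ} (ha : 0 < a)
    (hg : ∀ T, IntegrableOn g (Ioo 0 T)) (T : ℝ) : IntegrableOn (fracInt a g) (Ioo 0 T) :=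
  (fracIntegrable_one _).1 (fracIntegrable_fracInt one_pos ha
    (aestronglyMeasurable_of_integrableOn_Ioo hg) (fracIntegrable_of_one_le (by linarith) (hg T)))

theorem fracInt_one_fracInt {g : ℝ → ℂ} {a : ℝ} (ha : 0 < a)
    (hg : ∀ T, IntegrableOn g (Ioo 0 T)) (y : ℝ) :
    fracInt 1 (fracInt a g) y = fracInt (a + 1) g y := by
  rw [fracInt_fracInt one_pos ha (aestronglyMeasurable_of_integrableOn_Ioo hg)
    (fracIntegrable_of_one_le (by linarith) (hg y)), add_comm]

theorem fracInt_add {f g : ℝ → ℂ} {a y : ℝ} (hf : FracIntegrable a f y)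
    (hg : FracIntegrable a g y) :
    fracInt a (fun t => f t + g t) y = fracInt a f y + fracInt a g y := by
  simp only [fracInt, mul_add]
  exact integral_add hf hg

theorem fracInt_sub {f g : ℝ → ℂ} {a y : ℝ} (hf : FracIntegrable a f y)
    (hg : FracIntegrable a g y) :
    fracInt a (fun t => f t - g t) y = fracInt a f y - fracInt a g y := by
  simp only [fracInt, mul_sub]
  exact integral_sub hf hg

theorem fracIntegrable_const_mul_rlKernel {a q : ℝ} (ha : 0 < a) (hq : 0 < q) (c : ℂ) (y : ℝ) :
    FracIntegrable a (fun t => c * (rlKernel q t : ℂ)) y := by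
  refine (((integrable_rlKernel_conv_zero ha hq y).integrableOn (s := Ioi 0)).ofReal
    (𝕜 := ℂ) |>.const_mul c).congr (.of_forall fun t => ?_)
  simp only [RCLike.ofReal_mul, Complex.coe_algebraMap]
  ring

theorem fracInt_const_mul_rlKernel {a q : ℝ} (ha : 0 < a) (hq : 0 < q) (c : ℂ) (y : ℝ) :
    fracInt a (fun t => c * (rlKernel q t : ℂ)) y = c * (rlKernel (a + q) y : ℂ) := by
  rw [← setIntegral_rlKernel_mul_rlKernel ha hq, ← integral_complex_ofReal,
    ← integral_const_mul, fracInt]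
  refine integral_congr_ae (.of_forall fun t => ?_)
  push_cast
  ring

/-- Composing `D^(γ - 1)` with the fractional integral of order `γ` gives the plain integral. -/
theorem fracInt_rlD {γ : ℝ} (h0 : 0 < γ) (h1 : γ ≤ 1) {g : ℝ → ℂ}
    (hg : ∀ T, IntegrableOn g (Ioo 0 T)) (y : ℝ) :
    fracInt γ (rlD (γ - 1) g) y = fracInt 1 g y := by
  rcases h1.eq_or_lt with rfl | h1
  · rw [rlD_one_sub_one]
  · have e : EqOn (rlD (γ - 1) g) (fracInt (1 - γ) g) (Ioi 0) := fun t ht =>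
      rlD_sub_one_of_lt h1 ht g
    rw [fracInt_congr e, fracInt_fracInt h0 (by linarith)
      (aestronglyMeasurable_of_integrableOn_Ioo hg) (by
        rw [add_sub_cancel]; exact (fracIntegrable_one _).2 (hg y)), add_sub_cancel]

theorem fracInt_one_deriv {g : ℝ → ℂ} {l : ℂ} (hd : ∀ y, 0 < y → DifferentiableAt ℝ g y)
    (hl : Tendsto g (𝓝[>] 0) (𝓝 l)) (hg : ∀ T, IntegrableOn (deriv g) (Ioo 0 T)) {y : ℝ}
    (hy : 0 < y) : fracInt 1 (deriv g) y = g y - l := by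
  rw [fracInt_one hy.le]
  exact intervalIntegral.integral_eq_sub_of_hasDerivAt_of_tendsto hy
    (fun x hx => (hd x hx.1).hasDerivAt)
    ((intervalIntegrable_iff_integrableOn_Ioo_of_le hy.le).2 (hg y)) hl
    ((hd y hy).continuousAt.tendsto.mono_left nhdsWithin_le_nhds)

namespace IsCauchySolution

variable {γ : ℕ → ℝ} {m : ℕ} {s : ℝ} {lam : ℂ} {A : ℕ → ℂ} {u : ℝ → ℂ}

theorem continuousOn (h : IsCauchySolution γ m s lam A u) {k : ℕ} (hk : k < m) :
    ContinuousOn (dnAlphaOp γ k u) (Ioi 0) := fun y hy =>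
  (h.defined.diff k hk y hy).continuousAt.continuousWithinAt

theorem eqOn_top (h : IsCauchySolution γ m s lam A u) (hγ : ∀ k ≤ m, 0 < γ k ∧ γ k ≤ 1) :
    EqOn (dnAlphaOp γ m u) (fun y => lam * ((y ^ s : ℝ) : ℂ) * u y) (Ioi 0) := fun y hy => by
  rw [← dnOp_eq_dnAlphaOp hγ u m le_rfl]
  exact h.equation y hy

/-- For `γ 0 < 1` this is part of the definition of a solution; for `γ 0 = 1` the initial condition
bounds `u` near the origin. -/
theorem integrableOn (h : IsCauchySolution γ m s lam A u) (hγ : ∀ k ≤ m, 0 < γ k ∧ γ k ≤ 1)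
    (hm : 0 < m) (T : ℝ) : IntegrableOn u (Ioo 0 T) := by
  rcases le_or_gt T 0 with hT | hT
  · simp [Ioo_eq_empty_of_le hT]
  obtain ⟨h0, h1⟩ := hγ 0 hm.le
  rcases h1.eq_or_lt with h1 | h1
  · have e : dnAlphaOp γ 0 u = u := by
      rw [dnAlphaOp, h1, rlD_one_sub_one]
    have := integrableOn_of_tendsto (h.continuousOn hm) (h.initial 0 hm) T
    rwa [e] at this
  · exact integrableOn_of_fracIntegrable (by linarith) (by linarith)
      ((rlDefined_iff h1 _).1 h.defined.int_zero T hT)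

theorem integrableOn_dnAlphaOp (h : IsCauchySolution γ m s lam A u)
    (hγ : ∀ k ≤ m, 0 < γ k ∧ γ k ≤ 1) (hm : 0 < m) (hs : 0 ≤ s) {k : ℕ} (hk : k ≤ m) (T : ℝ) :
    IntegrableOn (dnAlphaOp γ k u) (Ioo 0 T) := by
  rcases hk.eq_or_lt with rfl | hk
  · exact (integrableOn_congr_fun (fun y hy => h.eqOn_top hγ hy.1) measurableSet_Ioo).2
      (integrableOn_rpow_mul hs lam (h.integrableOn hγ hm T))
  · exact integrableOn_of_tendsto (h.continuousOn hk) (h.initial k hk) T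

theorem integrableOn_deriv (h : IsCauchySolution γ m s lam A u)
    (hγ : ∀ k ≤ m, 0 < γ k ∧ γ k ≤ 1) (hs : 0 ≤ s) {k : ℕ} (hk : k < m) (T : ℝ) :
    IntegrableOn (deriv (dnAlphaOp γ k u)) (Ioo 0 T) := by
  rcases le_or_gt T 0 with hT | hT
  · simp [Ioo_eq_empty_of_le hT]
  obtain ⟨h0, h1⟩ := hγ (k + 1) hk
  rcases h1.eq_or_lt with h1 | h1
  · have e : dnAlphaOp γ (k + 1) u = deriv (dnAlphaOp γ k u) := by
      rw [dnAlphaOp, h1, rlD_one_sub_one]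
    rw [← e]
    exact h.integrableOn_dnAlphaOp hγ (by omega) hs hk T
  · exact integrableOn_of_fracIntegrable (by linarith) (by linarith)
      ((rlDefined_iff h1 _).1 (h.defined.int_succ k hk) T hT)

/-- Inversion of one step of the definition of the operators `D^{α_k}`. -/
theorem dnAlphaOp_eq (h : IsCauchySolution γ m s lam A u)
    (hγ : ∀ k ≤ m, 0 < γ k ∧ γ k ≤ 1) (hs : 0 ≤ s) {k : ℕ} (hk : k < m) {y : ℝ} (hy : 0 < y) :
    dnAlphaOp γ k u y = A k + fracInt (γ (k + 1)) (dnAlphaOp γ (k + 1) u) y := by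
  rw [dnAlphaOp, fracInt_rlD (hγ _ hk).1 (hγ _ hk).2 (h.integrableOn_deriv hγ hs hk),
    fracInt_one_deriv (h.defined.diff k hk) (h.initial k hk) (h.integrableOn_deriv hγ hs hk) hy]
  ring

/-- Iterated inversion of the operators, up to `D^{α_j}`. -/
theorem fracInt_one_eq_add_dnAlphaOp (h : IsCauchySolution γ m s lam A u)
    (hγ : ∀ k ≤ m, 0 < γ k ∧ γ k ≤ 1) (hα : 0 < dnAlpha γ m) (hm : 0 < m) (hs : 0 ≤ s) (y : ℝ)
    {j : ℕ} (hj : j ≤ m) :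
    fracInt 1 u y = ∑ k ∈ Finset.range j, A k * (rlKernel (dnAlpha γ k + 1 + 1) y : ℂ) +
      fracInt (dnAlpha γ j + 1) (dnAlphaOp γ j u) y := by
  induction j with
  | zero =>
    rw [dnAlpha_zero, sub_add_cancel, dnAlphaOp,
      fracInt_rlD (hγ 0 hj).1 (hγ 0 hj).2 (h.integrableOn hγ hm)]
    simp
  | succ j ih =>
    have hpos := dnAlpha_add_one_pos hγ (k := j) (by omega)
    have hγj := (hγ (j + 1) hj).1
    have hadd : dnAlpha γ j + 1 + γ (j + 1) = dnAlpha γ (j + 1) + 1 := by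
      rw [dnAlpha_succ]; ring
    -- below the top index the functions are bounded near the origin; at the top index the order
    -- of integration is at least one
    have hfi : FracIntegrable (dnAlpha γ j + 1 + γ (j + 1)) (dnAlphaOp γ (j + 1) u) y := by
      rw [hadd]
      rcases hj.eq_or_lt with hj' | hj'
      · refine fracIntegrable_of_one_le ?_ (h.integrableOn_dnAlphaOp hγ hm hs hj y)
        rw [hj']
        linarith
      · exact fracIntegrable_of_tendsto (h.continuousOn hj') (h.initial _ hj')
          (dnAlpha_add_one_pos hγ hj) y
    have hmeas := aestronglyMeasurable_of_integrableOn_Ioo (h.integrableOn_dnAlphaOp hγ hm hs hj)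
    have e : EqOn (dnAlphaOp γ j u) (fun t => A j * (rlKernel 1 t : ℂ) +
        fracInt (γ (j + 1)) (dnAlphaOp γ (j + 1) u) t) (Ioi 0) := fun t ht => by
      simp only
      rw [h.dnAlphaOp_eq hγ hs hj ht, rlKernel_one_of_pos ht]
      simp
    rw [ih (by omega), Finset.sum_range_succ, fracInt_congr e,
      fracInt_add (fracIntegrable_const_mul_rlKernel hpos one_pos _ y)
        (fracIntegrable_fracInt hpos hγj hmeas hfi),
      fracInt_const_mul_rlKernel hpos one_pos, fracInt_fracInt hpos hγj hmeas hfi, hadd]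
    ring

/-- The Cauchy problem in integrated form. -/
theorem fracInt_one_eq (h : IsCauchySolution γ m s lam A u)
    (hγ : ∀ k ≤ m, 0 < γ k ∧ γ k ≤ 1) (hα : 0 < dnAlpha γ m) (hm : 0 < m) (hs : 0 ≤ s) (y : ℝ) :
    fracInt 1 u y = ∑ k ∈ Finset.range m, A k * (rlKernel (dnAlpha γ k + 1 + 1) y : ℂ) +
      fracInt (dnAlpha γ m + 1) (fun t => lam * ((t ^ s : ℝ) : ℂ) * u t) y := by
  rw [h.fracInt_one_eq_add_dnAlphaOp hγ hα hm hs y le_rfl, fracInt_congr (h.eqOn_top hγ)]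

end IsCauchySolution

section

variable {γ : ℕ → ℝ} {m : ℕ} {s : ℝ}

theorem integrableOn_cauchyFormula (hγ : ∀ k ≤ m, 0 < γ k ∧ γ k ≤ 1) (hα : 0 < dnAlpha γ m)
    (hs : 0 ≤ s) (lam : ℂ) (A : ℕ → ℂ) (T : ℝ) :
    IntegrableOn (cauchyFormula γ m s lam A) (Ioo 0 T) := by
  rcases le_or_gt T 0 with hT | hT
  · simp [Ioo_eq_empty_of_le hT]
  refine (fracIntegrable_one _).1 ((fracIntegrable_congr fun y hy =>
    cauchyFormula_eq_kernelSeries hγ hα hs lam A hy).2 ?_)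
  exact (fracInt_kernelSeries (kernelSummable_cauchy hγ hα hs lam A)
    (fun p _ => cauchyExp_pos hγ hα hs p) one_pos hT).1

theorem fracInt_one_cauchyFormula (hγ : ∀ k ≤ m, 0 < γ k ∧ γ k ≤ 1) (hα : 0 < dnAlpha γ m)
    (hs : 0 ≤ s) (lam : ℂ) (A : ℕ → ℂ) (y : ℝ) :
    fracInt 1 (cauchyFormula γ m s lam A) y =
      ∑ k ∈ Finset.range m, A k * (rlKernel (dnAlpha γ k + 1 + 1) y : ℂ) +
      fracInt (dnAlpha γ m + 1)
        (fun t => lam * ((t ^ s : ℝ) : ℂ) * cauchyFormula γ m s lam A t) y := by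
  have hint := fun T => integrableOn_rpow_mul hs lam (integrableOn_cauchyFormula hγ hα hs lam A T)
  have hk : ∀ k ∈ Finset.range m,
      FracIntegrable 1 (fun t => A k * (rlKernel (dnAlpha γ k + 1) t : ℂ)) y := fun k hk =>
    fracIntegrable_const_mul_rlKernel one_pos
      (dnAlpha_add_one_pos hγ (Finset.mem_range.1 hk).le) _ y
  have hF : FracIntegrable 1
      (fun t => ∑ k ∈ Finset.range m, A k * (rlKernel (dnAlpha γ k + 1) t : ℂ)) y := by
    simp only [FracIntegrable, Finset.mul_sum]
    exact integrable_finsetSum _ hk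
  have hF' : fracInt 1
      (fun t => ∑ k ∈ Finset.range m, A k * (rlKernel (dnAlpha γ k + 1) t : ℂ)) y =
      ∑ k ∈ Finset.range m, A k * (rlKernel (dnAlpha γ k + 1 + 1) y : ℂ) := by
    simp only [fracInt, Finset.mul_sum]
    rw [integral_finsetSum _ hk]
    refine Finset.sum_congr rfl fun k hk => ?_
    have := fracInt_const_mul_rlKernel one_pos
      (dnAlpha_add_one_pos hγ (Finset.mem_range.1 hk).le) (A k) y
    rw [add_comm (1 : ℝ)] at this
    exact this
  rw [fracInt_congr fun t ht => (cauchyFormula_eq_add_fracInt hγ hα hs lam A ht).2,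
    fracInt_add hF ((fracIntegrable_one _).2 (integrableOn_fracInt hα hint y)), hF',
    fracInt_one_fracInt hα hint]

theorem IsCauchySolution.ae_eq_cauchyFormula {lam : ℂ} {A : ℕ → ℂ} {u : ℝ → ℂ}
    (h : IsCauchySolution γ m s lam A u) (hγ : ∀ k ≤ m, 0 < γ k ∧ γ k ≤ 1)
    (hα : 0 < dnAlpha γ m) (hm : 0 < m) (hs : 0 ≤ s) :
    ∀ᵐ y ∂(volume.restrict (Ioi (0 : ℝ))), u y = cauchyFormula γ m s lam A y := by
  set U := cauchyFormula γ m s lam A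
  have hu := h.integrableOn hγ hm
  have hU := integrableOn_cauchyFormula hγ hα hs lam A
  set v : ℝ → ℂ := fun t => u t - U t with hv
  have hvint : ∀ T, IntegrableOn v (Ioo 0 T) := fun T => (hu T).sub (hU T)
  have hw := fun T => integrableOn_rpow_mul hs lam (hvint T)
  have hα1 : 1 ≤ dnAlpha γ m + 1 := by linarith
  have h1 : ∀ y, 0 < y → fracInt 1 v y =
      fracInt 1 (fracInt (dnAlpha γ m) fun t => lam * ((t ^ s : ℝ) : ℂ) * v t) y := fun y hy => by
    have e : (fun t => lam * ((t ^ s : ℝ) : ℂ) * v t) = fun t =>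
        lam * ((t ^ s : ℝ) : ℂ) * u t - lam * ((t ^ s : ℝ) : ℂ) * U t := by
      ext t
      rw [hv, mul_sub]
    rw [fracInt_one_fracInt hα hw, e,
      fracInt_sub (fracIntegrable_of_one_le hα1 (integrableOn_rpow_mul hs lam (hu y)))
        (fracIntegrable_of_one_le hα1 (integrableOn_rpow_mul hs lam (hU y))),
      hv, fracInt_sub ((fracIntegrable_one _).2 (hu y)) ((fracIntegrable_one _).2 (hU y)),
      h.fracInt_one_eq hγ hα hm hs y, fracInt_one_cauchyFormula hγ hα hs lam A y]
    ring
  have h2 := ae_eq_zero_of_fracInt_one_eq_zero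
    (fun T => (hvint T).sub (integrableOn_fracInt hα hw T)) fun y hy => by
      rw [← sub_eq_zero.2 (h1 y hy)]
      exact fracInt_sub ((fracIntegrable_one _).2 (hvint y))
        ((fracIntegrable_one _).2 (integrableOn_fracInt hα hw y))
  have h3 := ae_eq_zero_of_eq_fracInt hα hs lam hvint (h2.mono fun y hy => sub_eq_zero.1 hy)
  exact h3.mono fun y hy => sub_eq_zero.1 hy

end

theorem mainTheorem2 (m : ℕ) (γ : ℕ → ℝ) (hγ : ∀ k ≤ m, 0 < γ k ∧ γ k ≤ 1)
    (hα : 0 < dnAlpha γ m) (s : ℝ) (hs : 0 ≤ s) (lam : ℂ) (A : ℕ → ℂ) :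
    -- the Kilbas-Saigo series in the formula converge absolutely for every argument
    (∀ k < m, ∀ z : ℂ, Summable fun i : ℕ =>
      ‖(kilbasSaigoCoeff (dnAlpha γ m) ((dnAlpha γ m + s) / dnAlpha γ m)
        ((dnAlpha γ k + s) / dnAlpha γ m) i : ℂ) * z ^ i‖) ∧
    ContinuousOn (cauchyFormula γ m s lam A) (Ioi 0) ∧
    -- the formula solves the Cauchy problem
    ((lam ≠ 0 → ∀ k < m, A k ≠ 0 →
        dnAlpha γ (m - 1) < dnAlpha γ m + s + dnAlpha γ k) →
      IsCauchySolution γ m s lam A (cauchyFormula γ m s lam A)) ∧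
    -- every solution of the Cauchy problem is given by the formula
    (∀ u : ℝ → ℂ, IsCauchySolution γ m s lam A u →
      (∀ᵐ y ∂(volume.restrict (Ioi (0 : ℝ))), u y = cauchyFormula γ m s lam A y) ∧
      (ContinuousOn u (Ioi 0) → ∀ y : ℝ, 0 < y → u y = cauchyFormula γ m s lam A y)) := by
  -- `α_0 = γ_0 - 1 ≤ 0`
  have hm : 0 < m := by
    rcases Nat.eq_zero_or_pos m with rfl | h
    · rw [dnAlpha_zero] at hα
      linarith [(hγ 0 le_rfl).2]
    · exact h
  refine ⟨fun k _ z => summable_kilbasSaigo hα (by positivity) _ z,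
    continuousOn_cauchyFormula hγ hα hs lam A, isCauchySolution_cauchyFormula hγ hα hs,
    fun u h => ?_⟩
  have hae := h.ae_eq_cauchyFormula hγ hα hm hs
  exact ⟨hae, fun hc y hy => Measure.eqOn_open_of_ae_eq hae isOpen_Ioi hc
    (continuousOn_cauchyFormula hγ hα hs lam A) hy⟩
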